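/- Let $S$ be a countable right LCM semigroup, that is, a left cancellative semigroup with identity $e$ such that for all $s,t\in S$ either $sS\cap tS=\emptyset$ or $sS\cap tS=rS$ for some $r\in S$. Let $C^*(S)$ be the universal unital C$^*$-algebra generated by isometries $v_s$ ($s\in S$) with $v_e=1$, $v_sv_t=v_{st}$, $v_sv_s^*v_tv_t^*=v_rv_r^*$ if $sS\cap tS=rS$, and $v_sv_s^*v_tv_t^*=0$ if $sS\cap tS=\emptyset$. Let $N\colon S\to([1,+\infty),\cdot)$ be a homomorphism (a scale), let $\ker N=N^{-1}(1)$, and let $\sigma^N$ be the dynamics on $C^*(S)$ with $\sigma^N_t(v_s)=N(s)^{it}v_s$. A $\sigma^N$-KMS$_1$-state is a state $\varphi$ on $C^*(S)$ such that $\varphi(xy)=\varphi(y\,\sigma^N_{i}(x))$ for all $x,y$ in a dense $\sigma^N$-invariant subspace of $\sigma^N$-analytic elements. Let $E(S)=\{e_s\mid s\in S\}\cup\{0\}$ be the semilattice in which $e_s$ is the identity map on $sS$ and $0$ is the empty map (so products correspond to intersections of domains), let $\widehat{E(S)}$ be the space of nonzero multiplicative maps $\chi\colon E(S)\to\{0,1\}$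 with $\chi(0)=0$, with the topology of pointwise convergence, and put $Z_s=\{\chi\mid\chi(e_s)=1\}$. Assume that there is a Borel probability measure $\mu_N$ on $\widehat{E(S)}$ with $\mu_N(Z_s)=N(s)^{-1}$ for all $s\in S$, or that there is a $\sigma^N$-KMS$_1$-state on $C^*(S)$ (these two assumptions are equivalent). Assume in addition that $1$ is an isolated point of $N(S)\subset[1,+\infty)$. Write $s\sim_N t$ if $sa=tb$ for some $a,b\in\ker N$; under the above assumptions this is an equivalence relation. Order $S/{\sim_N}$ by $[s]\le[t]$ iff $t'\in sS$ for some $t'\sim_N t$, and let $a[t]=[at]$. For a finite nonempty $K\subset S/{\sim_N}$ let $[q_K]=\bigvee_{[s]\in K}[s]$, with $N(q_K)^{-1}:=0$ if $K$ has no least upper bound. For $a,b\in S$ let $B^{a,b}$ be the set of classes $[s]$ such that $s'=at=bt$ for some $s'\sim_N s$ and $t\in S$, and put $$A(a,b)=\lim_{F}\sum_{\emptyset\ne K\subset F}(-1)^{|K|+1}N(q_K)^{-1},$$ the limit being over the finite subsets $F$ of $B^{a,b}$ ordered by inclusion. For $a,b\in S$ with $aS\cap bS\ne\emptyset$ put $$\Phi(a,b)=\lim_{F}\sum_{[s]\in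 T_F^{a,b}}\Big(N(s)^{-1}+\sum_{\emptyset\ne K\subset F_s}(-1)^{|K|}N(q_K)^{-1}\Big),$$ the limit being over the finite $\vee$-closed subsets $F$ of $\{[t]\mid[a]\vee[b]\le[t]\}$ containing $[a]\vee[b]$, ordered by inclusion, where a set is $\vee$-closed if it contains the least upper bound of any two of its elements that have one, $F_s$ is the set of elements of $F$ strictly larger than $[s]$, and $T_F^{a,b}$ is the set of $[s]\in F$ for which there is $[t]\in S/{\sim_N}$ with $[s]\le a[t]$, $[s]\le b[t]$, but $[r]\not\le a[t]$ and $[r]\not\le b[t]$ for all $[r]\in F_s$. Then: (1) There is a canonical $*$-homomorphism $C^*(\ker N)\to C^*(S)$, $v_t\mapsto v_t$, and every $\sigma^N$-KMS$_1$-state on $C^*(S)$ is completely determined by its restriction to $C^*(\ker N)$ along it: two $\sigma^N$-KMS$_1$-states with the same restriction are equal. (2) The limits $A(a,b)$ and $\Phi(a,b)$ exist and are unique for all $a,b\in S$ with $aS\cap bS\ne\emptyset$. If $A(a,b)\ne\Phi(a,b)$ for some $a,b\in S$ with $a\ne b$, $aS\cap bS\ne\emptyset$ and $N(a)=N(b)$,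 then the same is true already for some $a,b\in\ker N$. -/

import Mathlib

open Filter Topology MeasureTheory
open scoped ENNReal ComplexOrder

namespace RightLCM

universe u

/-! ### Right LCM semigroups and scales -/

/-- The principal right ideal `sS`. -/
def rightIdeal {S : Type*} [Monoid S] (s : S) : Set S := Set.range fun x => s * x

/-- The right LCM property of a monoid (left cancellation is assumed separately): two principal
right ideals are disjoint or intersect in a principal right ideal. -/
def IsRightLCM (S : Type*) [Monoid S] : Prop :=
  ∀ s t : S, rightIdeal s ∩ rightIdeal t = ∅ ∨
    ∃ r : S, rightIdeal s ∩ rightIdeal t = rightIdeal r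

/-- A scale: a homomorphism `N : S → ([1, ∞), ·)`. -/
structure Scale (S : Type*) [Monoid S] where
  toHom : S →* ℝ
  one_le : ∀ s, 1 ≤ toHom s

instance {S : Type*} [Monoid S] : CoeFun (Scale S) fun _ => S → ℝ := ⟨fun N => N.toHom⟩

/-- The naive kernel `N⁻¹(1)`. -/
def Scale.ker {S : Type*} [Monoid S] (N : Scale S) : Submonoid S := MonoidHom.mker N.toHom

/-- `1` is an isolated point of `N(S) ⊆ [1, ∞)`. -/
def Scale.OneIsolated {S : Type*} [Monoid S] (N : Scale S) : Prop :=
  ∃ U ∈ 𝓝 (1 : ℝ), U ∩ Set.range N.toHom = {1}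

/-! ### The semigroup C*-algebra -/

/-- A family of elements of a unital C*-algebra satisfying the defining relations of `C*(S)`. -/
structure IsRep {S : Type*} [Monoid S] {A : Type*} [CStarAlgebra A] (v : S → A) : Prop where
  map_one : v 1 = 1
  map_mul : ∀ s t, v (s * t) = v s * v t
  isometry : ∀ s, star (v s) * v s = 1
  range_mul : ∀ s t r, rightIdeal s ∩ rightIdeal t = rightIdeal r →
    v s * star (v s) * (v t * star (v t)) = v r * star (v r)
  range_orth : ∀ s t, rightIdeal s ∩ rightIdeal t = ∅ →
    v s * star (v s) * (v t * star (v t)) = 0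

/-- A representation of the defining relations of `C*(S)` in some nonzero unital C*-algebra. -/
structure Rep (S : Type u) [Monoid S] : Type (u + 1) where
  Alg : Type u
  [cstar : CStarAlgebra Alg]
  [nontrivial : Nontrivial Alg]
  v : S → Alg
  isRep : IsRep v

attribute [instance] Rep.cstar Rep.nontrivial

noncomputable section

/-- The C*-algebra of bounded families indexed by all representations. -/
abbrev RepProd (S : Type u) [Monoid S] : Type (u + 1) := lp (fun V : Rep S => V.Alg) ∞

lemma IsRep.norm_le {S : Type*} [Monoid S] {A : Type*} [CStarAlgebra A] {v : S → A}
    (h : IsRep v) (s : S) : ‖v s‖ ≤ 1 := by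
  nontriviality A
  have h1 : ‖v s‖ * ‖v s‖ = 1 := by
    rw [← CStarRing.norm_star_mul_self, h.isometry, norm_one]
  nlinarith [norm_nonneg (v s)]

/-- The universal family of isometries, inside the product of all representations. -/
def prodGen {S : Type u} [Monoid S] (s : S) : RepProd S :=
  ⟨fun V => V.v s, memℓp_infty ⟨1, by rintro _ ⟨V, rfl⟩; exact V.isRep.norm_le s⟩⟩

/-- `C*(S)`, as the C*-subalgebra of the product of all representations that is generated by the
universal family of isometries. -/
def cstarSub (S : Type u) [Monoid S] : StarSubalgebra ℂ (RepProd S) :=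
  (StarAlgebra.adjoin ℂ (Set.range (prodGen (S := S)))).topologicalClosure

/-- The semigroup C*-algebra `C*(S)`, universal for the relations in `IsRep`
(see `CS.gen_isRep` and `CS.exists_lift`). -/
abbrev CS (S : Type u) [Monoid S] : Type (u + 1) := cstarSub S

instance (S : Type u) [Monoid S] : CompleteSpace (CS S) :=
  (StarSubalgebra.isClosed_topologicalClosure _).completeSpace_coe

instance (S : Type u) [Monoid S] : CStarAlgebra (CS S) where

/-- The canonical isometry `v_s ∈ C*(S)`. -/
def CS.gen {S : Type u} [Monoid S] (s : S) : CS S :=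
  ⟨prodGen s, StarSubalgebra.le_topologicalClosure _
    (StarAlgebra.subset_adjoin ℂ _ (Set.mem_range_self s))⟩

lemma CS.gen_isRep (S : Type u) [Monoid S] : IsRep (CS.gen (S := S)) where
  map_one := by
    apply Subtype.ext; apply lp.ext; funext V; exact V.isRep.map_one
  map_mul s t := by
    apply Subtype.ext; apply lp.ext; funext V; exact V.isRep.map_mul s t
  isometry s := by
    apply Subtype.ext; apply lp.ext; funext V; exact V.isRep.isometry s
  range_mul s t r h := by
    apply Subtype.ext; apply lp.ext; funext V; exact V.isRep.range_mul s t r h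
  range_orth s t h := by
    apply Subtype.ext; apply lp.ext; funext V; exact V.isRep.range_orth s t h

/-- Evaluation of bounded families at one representation. -/
def evalHom {S : Type u} [Monoid S] (V : Rep S) : RepProd S →⋆ₐ[ℂ] V.Alg where
  toFun f := f V
  map_one' := rfl
  map_mul' _ _ := rfl
  map_zero' := rfl
  map_add' _ _ := rfl
  commutes' _ := rfl
  map_star' _ := rfl

/-- The universal property of `C*(S)`. -/
lemma CS.exists_lift {S : Type u} [Monoid S] {A : Type u} [CStarAlgebra A] [Nontrivial A]
    {w : S → A} (hw : IsRep w) : ∃ π : CS S →⋆ₐ[ℂ] A, ∀ s, π (CS.gen s) = w s :=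
  ⟨(evalHom (⟨A, w, hw⟩ : Rep S)).comp (cstarSub S).subtype, fun _ => rfl⟩

/-! ### The dynamics `σ^N` -/

/-- The phase `N(s)^{it}`. -/
def Scale.phase {S : Type*} [Monoid S] (N : Scale S) (t : ℝ) (s : S) : ℂ :=
  (N s : ℂ) ^ ((t : ℂ) * Complex.I)

lemma Scale.phase_star_mul {S : Type*} [Monoid S] (N : Scale S) (t : ℝ) (s : S) :
    star (N.phase t s) * N.phase t s = 1 := by
  have h : ‖N.phase t s‖ = 1 := by
    rw [Scale.phase, Complex.norm_cpow_eq_rpow_re_of_pos (by linarith [N.one_le s])]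
    simp
  have := Complex.conj_mul' (N.phase t s)
  rw [h] at this
  simpa using this

lemma IsRep.twist {S : Type*} [Monoid S] {A : Type*} [CStarAlgebra A] {v : S → A}
    (h : IsRep v) (N : Scale S) (t : ℝ) : IsRep fun s => N.phase t s • v s := by
  have hp : ∀ s, (N.phase t s • v s) * star (N.phase t s • v s) = v s * star (v s) := by
    intro s
    rw [star_smul, smul_mul_smul_comm, mul_comm, N.phase_star_mul, one_smul]
  refine ⟨?_, ?_, ?_, ?_, ?_⟩
  · simp [Scale.phase, h.map_one]
  · intro s r
    have hN : N.phase t (s * r) = N.phase t s * N.phase t r := by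
      rw [Scale.phase, N.toHom.map_mul, Complex.ofReal_mul]
      exact Complex.mul_cpow_ofReal_nonneg (by linarith [N.one_le s]) (by linarith [N.one_le r]) _
    rw [hN, h.map_mul, smul_mul_smul_comm]
  · intro s
    rw [star_smul, smul_mul_smul_comm, N.phase_star_mul, one_smul, h.isometry]
  · intro s r q hq
    rw [hp, hp, hp]; exact h.range_mul s r q hq
  · intro s r hr
    rw [hp, hp]; exact h.range_orth s r hr

/-- The representation `s ↦ N(s)^{it} V_s`. -/
def Rep.twist {S : Type u} [Monoid S] (N : Scale S) (t : ℝ) (V : Rep S) : Rep S :=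
  ⟨V.Alg, fun s => N.phase t s • V.v s, V.isRep.twist N t⟩

/-- The dynamics on the product of all representations: `(σ_t f)(V) = f(N^{it} V)`. -/
def prodDyn {S : Type u} [Monoid S] (N : Scale S) (t : ℝ) : RepProd S →⋆ₐ[ℂ] RepProd S where
  toFun f := ⟨fun V => f (V.twist N t), memℓp_infty ⟨‖f‖, by
    rintro _ ⟨V, rfl⟩; exact lp.norm_apply_le_norm ENNReal.top_ne_zero f (V.twist N t)⟩⟩
  map_one' := rfl
  map_mul' _ _ := rfl
  map_zero' := rfl
  map_add' _ _ := rfl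
  commutes' _ := rfl
  map_star' _ := rfl

lemma prodDyn_gen {S : Type u} [Monoid S] (N : Scale S) (t : ℝ) (s : S) :
    prodDyn N t (prodGen s) = N.phase t s • prodGen s := rfl

lemma prodDyn_mem {S : Type u} [Monoid S] (N : Scale S) (t : ℝ) {f : RepProd S}
    (hf : f ∈ cstarSub S) : prodDyn N t f ∈ cstarSub S := by
  have hcont : Continuous (prodDyn N t) := by
    refine AddMonoidHomClass.continuous_of_bound (prodDyn N t) 1 fun f => ?_
    rw [one_mul]
    refine lp.norm_le_of_forall_le (norm_nonneg f) fun V => ?_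
    exact lp.norm_apply_le_norm ENNReal.top_ne_zero f (V.twist N t)
  have hle : StarAlgebra.adjoin ℂ (Set.range (prodGen (S := S))) ≤
      (cstarSub S).comap (prodDyn N t) := by
    refine StarAlgebra.adjoin_le ?_
    rintro _ ⟨s, rfl⟩
    change prodDyn N t (prodGen s) ∈ cstarSub S
    rw [prodDyn_gen]
    exact SMulMemClass.smul_mem _ (CS.gen s).2
  have hcl : IsClosed ((cstarSub S).comap (prodDyn N t) : Set (RepProd S)) :=
    (StarSubalgebra.isClosed_topologicalClosure _).preimage hcont
  exact StarSubalgebra.topologicalClosure_minimal hle hcl hf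

/-- The dynamics `σ^N` on `C*(S)`. -/
def dyn {S : Type u} [Monoid S] (N : Scale S) (t : ℝ) : CS S →⋆ₐ[ℂ] CS S :=
  ((prodDyn N t).comp (cstarSub S).subtype).codRestrict (cstarSub S)
    fun f => prodDyn_mem N t f.2

lemma dyn_gen {S : Type u} [Monoid S] (N : Scale S) (t : ℝ) (s : S) :
    dyn N t (CS.gen s) = ((N s : ℂ) ^ ((t : ℂ) * Complex.I)) • CS.gen s := rfl

/-! ### KMS-states -/

/-- A state on a unital C*-algebra: a unital positive (bounded) linear functional. -/
def IsState {A : Type*} [CStarAlgebra A] (φ : A →L[ℂ] ℂ) : Prop :=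
  φ 1 = 1 ∧ ∀ a, 0 ≤ φ (star a * a)

/-- `F` is the entire extension `z ↦ σ_z(a)` of the orbit of `a`. An element that has such an
extension (which is then unique) is `σ`-analytic. -/
def IsEntireOrbit {A : Type*} [CStarAlgebra A] (σ : ℝ → A →⋆ₐ[ℂ] A) (a : A) (F : ℂ → A) : Prop :=
  Differentiable ℂ F ∧ ∀ t : ℝ, F t = σ t a

/-- `φ` is a `σ`-KMS_β-state: `φ(ab) = φ(b σ_{iβ}(a))` for all `a`, `b` in a dense `σ`-invariant
subspace of `σ`-analytic elements. -/
def IsKMSState {A : Type*} [CStarAlgebra A] (σ : ℝ → A →⋆ₐ[ℂ] A) (β : ℝ) (φ : A →L[ℂ] ℂ) : Prop :=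
  IsState φ ∧ ∃ D : Submodule ℂ A, Dense (D : Set A) ∧ (∀ t, ∀ a ∈ D, σ t a ∈ D) ∧
    ∀ a ∈ D, ∃ F : ℂ → A, IsEntireOrbit σ a F ∧
      ∀ b ∈ D, φ (a * b) = φ (b * F ((β : ℂ) * Complex.I))

/-! ### The space of characters of the semilattice of idempotents -/

/-- The semilattice `E(S)`: the idempotent `e_s`, the identity map of `sS`, is recorded by its
domain `sS`, and `0` by `∅`; the product is the intersection. -/
def Idem (S : Type*) [Monoid S] : Type _ := {X : Set S // X = ∅ ∨ ∃ s, X = rightIdeal s}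

/-- The idempotent `e_s`. -/
def Idem.of {S : Type*} [Monoid S] (s : S) : Idem S := ⟨rightIdeal s, Or.inr ⟨s, rfl⟩⟩

/-- The zero idempotent. -/
def Idem.zero (S : Type*) [Monoid S] : Idem S := ⟨∅, Or.inl rfl⟩

/-- The space of characters: nonzero multiplicative maps `χ : E(S) → {0, 1}` with `χ(0) = 0`. -/
def CharSpace (S : Type*) [Monoid S] : Type _ :=
  {χ : Idem S → Bool // (∃ X, χ X = true) ∧ χ (Idem.zero S) = false ∧
    ∀ X Y Z : Idem S, Z.1 = X.1 ∩ Y.1 → χ Z = (χ X && χ Y)}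

/-- The topology of pointwise convergence. -/
instance (S : Type*) [Monoid S] : TopologicalSpace (CharSpace S) :=
  inferInstanceAs (TopologicalSpace (Subtype _))

instance (S : Type*) [Monoid S] : MeasurableSpace (CharSpace S) := borel _

instance (S : Type*) [Monoid S] : BorelSpace (CharSpace S) := ⟨rfl⟩

/-- The set `Z_s = {χ | χ(e_s) = 1}`. -/
def Z {S : Type*} [Monoid S] (s : S) : Set (CharSpace S) := {χ | χ.1 (Idem.of s) = true}

/-! ### The quasi-lattice `S/∼_N` -/

/-- `s ∼_N t` iff `sa = tb` for some `a, b ∈ ker N`. -/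
def simN {S : Type*} [Monoid S] (N : Scale S) (s t : S) : Prop :=
  ∃ a ∈ N.ker, ∃ b ∈ N.ker, s * a = t * b

/-- `S/∼_N`. (In the presence of a KMS_1-state `simN N` is an equivalence relation.) -/
def QuotN {S : Type*} [Monoid S] (N : Scale S) : Type _ := Quot (simN N)

namespace QuotN

variable {S : Type*} [Monoid S] {N : Scale S}

/-- The class `[s]`. -/
def mk (N : Scale S) (s : S) : QuotN N := Quot.mk _ s

/-- `N([s]) = N(s)`. -/
def scale : QuotN N → ℝ := Quot.lift N (by
  rintro s t ⟨a, ha, b, hb, h⟩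
  have := congrArg N.toHom h
  have ha' : N.toHom a = 1 := ha
  have hb' : N.toHom b = 1 := hb
  simpa [ha', hb'] using this)

/-- `[s] ≤ [t]` iff `t' ∈ s'S` for some representatives. -/
instance : LE (QuotN N) := ⟨fun x y => ∃ s t, mk N s = x ∧ mk N t = y ∧ t ∈ rightIdeal s⟩

/-- The action `a[t] = [at]`. -/
def act (a : S) : QuotN N → QuotN N := Quot.map (fun t => a * t) (by
  rintro s t ⟨c, hc, d, hd, h⟩
  exact ⟨c, hc, d, hd, by rw [mul_assoc, h, mul_assoc]⟩)

open Classical in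
/-- `N(q_K)⁻¹`, where `[q_K]` is the least upper bound of `K`; it is `0` if `[q_K] = ∞`. -/
def joinInv (K : Finset (QuotN N)) : ℝ :=
  if h : ∃ q, IsLUB (K : Set (QuotN N)) q then (scale h.choose)⁻¹ else 0

/-- `B^{a,b}`: the classes `[s]` such that `s' = at = bt` for some `s' ∼_N s` and `t ∈ S`. -/
def B (N : Scale S) (a b : S) : Set (QuotN N) :=
  {x | ∃ s' t, mk N s' = x ∧ s' = a * t ∧ s' = b * t}

open Classical in
/-- `∑_{∅ ≠ K ⊆ F} (-1)^{|K|} N(q_K)⁻¹`. -/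
def altSum (F : Finset (QuotN N)) : ℝ :=
  ∑ K ∈ F.powerset.filter (fun K => K.Nonempty), (-1) ^ K.card * joinInv K

/-- The finite subsets of `B^{a,b}`, ordered by inclusion. -/
abbrev TrivIndex (N : Scale S) (a b : S) : Type _ :=
  {F : Finset (QuotN N) // (F : Set (QuotN N)) ⊆ B N a b}

/-- `x` is the number
`lim_F ∑_{∅ ≠ K ⊆ F} (-1)^{|K|+1} N(q_K)⁻¹` over the finite subsets `F` of `B^{a,b}`. -/
def IsTrivNumber (N : Scale S) (a b : S) (x : ℝ) : Prop :=
  Tendsto (fun F : TrivIndex N a b => -altSum F.1) atTop (𝓝 x)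

open Classical in
/-- `F_s`: the elements of `F` strictly larger than `[s]`. -/
def above (F : Finset (QuotN N)) (x : QuotN N) : Finset (QuotN N) :=
  F.filter fun r => x ≤ r ∧ r ≠ x

open Classical in
/-- `T^{a,b}_F`: the `[s] ∈ F` for which there is `[t]` with `[s] ≤ a[t]`, `[s] ≤ b[t]`, but
`[r] ≰ a[t]`, `[r] ≰ b[t]` for all `[r] ∈ F_s`. -/
def T (a b : S) (F : Finset (QuotN N)) : Finset (QuotN N) :=
  F.filter fun x => ∃ y : QuotN N, x ≤ act a y ∧ x ≤ act b y ∧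
    ∀ r ∈ above F x, ¬ r ≤ act a y ∧ ¬ r ≤ act b y

/-- The finite `∨`-closed subsets of `{[t] | [a] ∨ [b] ≤ [t]}` containing `[a] ∨ [b]`, ordered by
inclusion. -/
abbrev FixIndex (N : Scale S) (a b : S) : Type _ :=
  {F : Finset (QuotN N) //
    (∃ m, IsLUB {mk N a, mk N b} m ∧ m ∈ F ∧ ∀ x ∈ F, m ≤ x) ∧
    ∀ x ∈ F, ∀ y ∈ F, ∀ z, IsLUB {x, y} z → z ∈ F}

/-- `y` is the number
`lim_F ∑_{[s] ∈ T^{a,b}_F} (N(s)⁻¹ + ∑_{∅ ≠ K ⊆ F_s} (-1)^{|K|} N(q_K)⁻¹)`. -/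
def IsFixNumber (N : Scale S) (a b : S) (y : ℝ) : Prop :=
  Tendsto (fun F : FixIndex N a b =>
    ∑ x ∈ T a b F.1, ((scale x)⁻¹ + altSum (above F.1 x))) atTop (𝓝 y)

/-- The uniqueness criterion fails at `(a, b)`: the two limits exist and are different. -/
def CriterionFails (N : Scale S) (a b : S) : Prop :=
  ∃ x y, IsTrivNumber N a b x ∧ IsFixNumber N a b y ∧ x ≠ y

end QuotN

end

end RightLCM

namespace RightLCM

/-! ### The order on `S/∼_N` -/

namespace Scale

variable {S : Type*} [Monoid S] (N : Scale S)

/-! Both claims rest on one contraction. If `a * p = b * q` generates `aS ∩ bS`, then passing from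
`(a, b)` to the complements `p`, `q` multiplies the relevant quantity by `(N a)⁻¹`, and `N a = N b`
forces `N p = N q`. Since `1` is isolated in the range of `N`, each step outside `ker N` gains a
fixed factor below `1`. A bounded quantity that vanishes on pairs from `ker N` therefore vanishes on
all pairs of equal scale (`Scale.OneIsolated.eq_zero_of_step`).

For KMS-states the quantity is the norm of `φ - ψ` at `v_s v_t^*`. The KMS condition turns `φ (v_s
v_t^*)` into `(N s)⁻¹ * φ (v_t^* v_s)`, and `v_t^* v_s` is `v_q v_p^*` or zero. Monomials with `N s
≠ N t` are killed by every KMS-state, and monomials span a dense subspace. The KMS condition is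
given only on some dense subspace that need not contain the `v_s`; `IsKMSState.apply_eigenvector`
extends it to them by a three lines argument.

For the criterion the quantity is `Φ(a,b) - A(a,b)`. Either assumption gives sets of measure `(N
s)⁻¹` that intersect like the ideals `sS` (`IsModel`). Such a model yields `KerOre`, which makes
`∼_N` an equivalence relation and `S/∼_N` a partial order, and a probability measure `ν` on join
ideals `H` of `S/∼_N` (`IsModel.exists_isSpectral`). By inclusion-exclusion and continuity of `ν`,
`A(a,b)` is the mass of the `H` that meet `B^{a,b}`, and `Φ(a,b)` is the mass of the `H` that
contain `[a]` and `[b]` and have equal preimages under `a` and `b` (`IsSpectral.isTrivNumber`,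
`IsSpectral.isFixNumber`). Hence both limits exist. Both events for `(a, b)` are pulled back from
those for `(p, q)` along `H ↦ a⁻¹H`, and this map scales `ν` by `(N a)⁻¹` (`IsSpectral.scaling`,
`IsSpectral.defect_eq_mul`). -/

lemma map_mul (a b : S) : N (a * b) = N a * N b := N.toHom.map_mul a b

lemma pos (a : S) : 0 < N a := lt_of_lt_of_le one_pos (N.one_le a)

lemma mem_ker {a : S} : a ∈ N.ker ↔ N a = 1 := Iff.rfl

variable {N}

lemma mem_ker_left {a b : S} (h : a * b ∈ N.ker) : a ∈ N.ker := by
  rw [mem_ker, map_mul] at h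
  rw [mem_ker]
  nlinarith [N.one_le a, N.one_le b]

lemma mem_ker_right {a b : S} (h : a * b ∈ N.ker) : b ∈ N.ker := by
  rw [mem_ker, map_mul] at h
  rw [mem_ker]
  nlinarith [N.one_le a, N.one_le b]

variable (N) in
/-- Every principal right ideal meets `cS` for `c ∈ ker N`, up to an element of `ker N`. -/
def KerOre : Prop := ∀ c ∈ N.ker, ∀ x : S, ∃ y ∈ N.ker, ∃ z, x * y = c * z

lemma KerOre.common (h : N.KerOre) {a b : S} (ha : a ∈ N.ker) (hb : b ∈ N.ker) :
    ∃ c ∈ N.ker, ∃ d ∈ N.ker, a * c = b * d := by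
  obtain ⟨c, hc, d, hcd⟩ := h b hb a
  exact ⟨c, hc, d, mem_ker_right (hcd ▸ mul_mem ha hc), hcd⟩

lemma KerOre.simN_equivalence (h : N.KerOre) : Equivalence (simN N) where
  refl s := ⟨1, one_mem _, 1, one_mem _, rfl⟩
  symm := fun ⟨a, ha, b, hb, e⟩ => ⟨b, hb, a, ha, e.symm⟩
  trans := by
    rintro s t r ⟨a, ha, b, hb, e⟩ ⟨c, hc, d, hd, e'⟩
    obtain ⟨p, hp, q, hq, hpq⟩ := h.common hb hc
    refine ⟨a * p, mul_mem ha hp, d * q, mul_mem hd hq, ?_⟩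
    rw [← mul_assoc, e, mul_assoc, hpq, ← mul_assoc, e', mul_assoc]

end Scale

lemma self_mem_rightIdeal {S : Type*} [Monoid S] (s : S) : s ∈ rightIdeal s := ⟨1, mul_one s⟩

lemma rightIdeal_subset {S : Type*} [Monoid S] {s t : S} (h : t ∈ rightIdeal s) :
    rightIdeal t ⊆ rightIdeal s := by
  obtain ⟨x, rfl⟩ := h
  rintro _ ⟨y, rfl⟩
  exact ⟨x * y, (mul_assoc s x y).symm⟩

/-- Two elements with a common right multiple have a least common right multiple. -/
lemma IsRightLCM.exists_lcm {S : Type*} [Monoid S] (hS : IsRightLCM S) {s t : S}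
    (h : (rightIdeal s ∩ rightIdeal t).Nonempty) :
    ∃ p q, s * p = t * q ∧ rightIdeal s ∩ rightIdeal t = rightIdeal (s * p) := by
  obtain h' | ⟨r, hr⟩ := hS s t
  · exact absurd h' h.ne_empty
  · have : r ∈ rightIdeal s ∩ rightIdeal t := hr ▸ self_mem_rightIdeal r
    obtain ⟨⟨p, hp⟩, q, hq⟩ := this
    exact ⟨p, q, hp.trans hq.symm, by rw [hr]; exact congrArg _ hp.symm⟩

namespace QuotN

variable {S : Type*} [Monoid S] {N : Scale S}

@[simp] lemma scale_mk (s : S) : scale (mk N s) = N s := rfl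

@[simp] lemma act_mk (a s : S) : act a (mk N s) = mk N (a * s) := rfl

lemma exists_rep (x : QuotN N) : ∃ s, mk N s = x := Quot.exists_rep x

instance [Countable S] : Countable (QuotN N) := inferInstanceAs (Countable (Quot _))

lemma act_mul (a b : S) (x : QuotN N) : act (a * b) x = act a (act b x) := by
  obtain ⟨s, rfl⟩ := exists_rep x
  simp [mul_assoc]

lemma scale_act (a : S) (x : QuotN N) : scale (act a x) = N a * scale x := by
  obtain ⟨s, rfl⟩ := exists_rep x
  simp [N.map_mul]

lemma scale_pos (x : QuotN N) : 0 < scale x := by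
  obtain ⟨s, rfl⟩ := exists_rep x
  exact N.pos s

lemma mk_eq_mk (h : N.KerOre) {s t : S} : mk N s = mk N t ↔ simN N s t :=
  ⟨fun e => h.simN_equivalence.eqvGen_iff.1 (Quot.eqvGen_exact e), fun e => Quot.sound e⟩

lemma mk_mul_ker {s a : S} (ha : a ∈ N.ker) : mk N (s * a) = mk N s :=
  Quot.sound ⟨1, one_mem _, a, ha, mul_one _⟩

lemma mk_le_mk_mul (s x : S) : mk N s ≤ mk N (s * x) := ⟨s, s * x, rfl, rfl, x, rfl⟩

/-- The order is defined by some choice of representatives. `KerOre` moves the kernel factor `c`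
past `x * a`, so prescribed representatives can be used, at the cost of multiplying `t` by an
element of `ker N`. -/
lemma mk_le_mk (h : N.KerOre) {s t : S} :
    mk N s ≤ mk N t ↔ ∃ a ∈ N.ker, ∃ x, t * a = s * x := by
  constructor
  · rintro ⟨s', t', hs, ht, x, rfl⟩
    obtain ⟨c, hc, d, hd, e⟩ := (mk_eq_mk h).1 hs
    obtain ⟨a, ha, b, hb, e'⟩ := (mk_eq_mk h).1 ht
    obtain ⟨y, hy, z, hz⟩ := h c hc (x * a)
    refine ⟨b * y, mul_mem hb hy, d * z, ?_⟩
    rw [← mul_assoc, ← e', mul_assoc, mul_assoc, ← mul_assoc x, hz, ← mul_assoc, e, mul_assoc]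
  · rintro ⟨a, ha, x, e⟩
    rw [← mk_mul_ker (s := t) ha, e]
    exact mk_le_mk_mul s x

/-- The partial order on `S/∼_N`. -/
abbrev partialOrder (h : N.KerOre) : PartialOrder (QuotN N) where
  toLE := inferInstance
  le_refl x := by
    obtain ⟨s, rfl⟩ := exists_rep x
    simpa using mk_le_mk_mul (N := N) s 1
  le_trans x y z hxy hyz := by
    obtain ⟨s, rfl⟩ := exists_rep x
    obtain ⟨t, rfl⟩ := exists_rep y
    obtain ⟨r, rfl⟩ := exists_rep z
    obtain ⟨a, ha, p, e⟩ := (mk_le_mk h).1 hxy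
    obtain ⟨b, hb, q, e'⟩ := (mk_le_mk h).1 hyz
    obtain ⟨y, hy, w, hw⟩ := h a ha q
    refine (mk_le_mk h).2 ⟨b * y, mul_mem hb hy, p * w, ?_⟩
    rw [← mul_assoc, e', mul_assoc, hw, ← mul_assoc, e, mul_assoc]
  le_antisymm x y hxy hyx := by
    obtain ⟨s, rfl⟩ := exists_rep x
    obtain ⟨t, rfl⟩ := exists_rep y
    obtain ⟨a, ha, p, e⟩ := (mk_le_mk h).1 hxy
    obtain ⟨b, hb, q, e'⟩ := (mk_le_mk h).1 hyx
    have h1 := congrArg N.toHom e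
    have h2 := congrArg N.toHom e'
    simp only [N.map_mul, N.mem_ker.1 ha, N.mem_ker.1 hb, mul_one] at h1 h2
    -- The two comparisons give `N p * N q = 1` with both factors at least `1`.
    have hp : p ∈ N.ker := by
      rw [N.mem_ker]
      have h3 : N s * (N p * N q - 1) = 0 := by rw [h1] at h2; linarith
      have h4 := (mul_eq_zero.1 h3).resolve_left (N.pos s).ne'
      nlinarith [N.one_le p, N.one_le q]
    exact (Quot.sound ⟨p, hp, a, ha, e.symm⟩ : mk N s = mk N t)

lemma mk_le_act (a : S) (x : QuotN N) : mk N a ≤ act a x := by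
  obtain ⟨s, rfl⟩ := exists_rep x
  exact mk_le_mk_mul a s

lemma exists_act_of_le (h : N.KerOre) {a : S} {x : QuotN N} (hx : mk N a ≤ x) :
    ∃ y, x = act a y := by
  obtain ⟨s, rfl⟩ := exists_rep x
  obtain ⟨c, hc, p, e⟩ := (mk_le_mk h).1 hx
  exact ⟨mk N p, by rw [act_mk, ← e, mk_mul_ker hc]⟩

lemma act_le_act [IsLeftCancelMul S] (h : N.KerOre) {a : S} {x y : QuotN N} :
    act a x ≤ act a y ↔ x ≤ y := by
  obtain ⟨s, rfl⟩ := exists_rep x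
  obtain ⟨t, rfl⟩ := exists_rep y
  simp only [act_mk, mk_le_mk h, mul_assoc, mul_right_inj]

lemma isLUB_pair_iff {x y z : QuotN N} :
    IsLUB {x, y} z ↔ x ≤ z ∧ y ≤ z ∧ ∀ w, x ≤ w → y ≤ w → z ≤ w := by
  simp only [IsLUB, IsLeast, upperBounds, lowerBounds, Set.mem_insert_iff, Set.mem_singleton_iff,
    Set.mem_ofPred_eq, forall_eq_or_imp, forall_eq]
  grind

lemma exists_common_of_le (h : N.KerOre) {s t : S} {z : QuotN N} (hs : mk N s ≤ z)
    (ht : mk N t ≤ z) : ∃ u, mk N u = z ∧ u ∈ rightIdeal s ∩ rightIdeal t := by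
  obtain ⟨r, rfl⟩ := exists_rep z
  obtain ⟨a, ha, p, e⟩ := (mk_le_mk h).1 hs
  obtain ⟨b, hb, q, e'⟩ := (mk_le_mk h).1 ht
  obtain ⟨c, hc, d, hd, hcd⟩ := h.common ha hb
  refine ⟨r * (a * c), mk_mul_ker (mul_mem ha hc), ⟨p * c, ?_⟩, q * d, ?_⟩
  · simp only [← mul_assoc, e]
  · rw [hcd]; simp only [← mul_assoc, e']

/-- Any upper bound of the two classes has a representative in both ideals, hence in the ideal of
`r`. -/
lemma isLUB_mk (h : N.KerOre) {s t r : S} (hr : rightIdeal s ∩ rightIdeal t = rightIdeal r) :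
    IsLUB {mk N s, mk N t} (mk N r) := by
  have : r ∈ rightIdeal s ∩ rightIdeal t := hr ▸ self_mem_rightIdeal r
  rw [isLUB_pair_iff]
  refine ⟨⟨s, r, rfl, rfl, this.1⟩, ⟨t, r, rfl, rfl, this.2⟩, fun w hs ht => ?_⟩
  obtain ⟨u, rfl, hu⟩ := exists_common_of_le h hs ht
  exact ⟨r, u, rfl, rfl, hr ▸ hu⟩

lemma exists_isLUB_pair (hS : IsRightLCM S) (h : N.KerOre) {x y z : QuotN N} (hx : x ≤ z)
    (hy : y ≤ z) : ∃ w, IsLUB {x, y} w := by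
  obtain ⟨s, rfl⟩ := exists_rep x
  obtain ⟨t, rfl⟩ := exists_rep y
  obtain ⟨u, -, hu⟩ := exists_common_of_le h hx hy
  obtain ⟨p, q, -, e⟩ := hS.exists_lcm ⟨u, hu⟩
  exact ⟨_, isLUB_mk h e⟩

lemma isLUB_insert (h : N.KerOre) {A : Set (QuotN N)} {x y z : QuotN N} (hy : IsLUB A y)
    (hz : IsLUB {x, y} z) : IsLUB (insert x A) z := by
  let := partialOrder h
  rw [isLUB_pair_iff] at hz
  refine ⟨?_, fun w hw => hz.2.2 w (hw (Set.mem_insert _ _))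
    (hy.2 fun v hv => hw (Set.mem_insert_of_mem _ hv))⟩
  rintro v (rfl | hv)
  · exact hz.1
  · exact (hy.1 hv).trans hz.2.1

/-- An upper bound of a nonempty set of translates lies above `[a]`, so it is itself a translate and
cancellation applies. For the empty set this fails: its join need not lie above `[a]`. -/
lemma isLUB_act [IsLeftCancelMul S] (h : N.KerOre) {A : Set (QuotN N)} (hA : A.Nonempty) {a : S}
    {z : QuotN N} : IsLUB (act a '' A) (act a z) ↔ IsLUB A z := by
  let := partialOrder h
  constructor
  · intro H
    refine ⟨fun x hx => (act_le_act h).1 (H.1 ⟨x, hx, rfl⟩), fun w hw => (act_le_act h).1 (H.2 ?_)⟩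
    rintro _ ⟨x, hx, rfl⟩
    exact (act_le_act h).2 (hw hx)
  · intro H
    refine ⟨?_, fun w hw => ?_⟩
    · rintro _ ⟨x, hx, rfl⟩
      exact (act_le_act h).2 (H.1 hx)
    · obtain ⟨x, hx⟩ := hA
      obtain ⟨y, rfl⟩ := exists_act_of_le h ((mk_le_act a x).trans (hw ⟨x, hx, rfl⟩))
      exact (act_le_act h).2 (H.2 fun v hv => (act_le_act h).1 (hw ⟨v, hv, rfl⟩))

lemma exists_eq_act_of_isLUB (h : N.KerOre) {A : Set (QuotN N)} (hA : A.Nonempty) {a : S}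
    {z : QuotN N} (hz : IsLUB (act a '' A) z) : ∃ y, z = act a y := by
  let := partialOrder h
  obtain ⟨x, hx⟩ := hA
  exact exists_act_of_le h ((mk_le_act a x).trans (hz.1 ⟨x, hx, rfl⟩))

lemma joinInv_of_isLUB (h : N.KerOre) {K : Finset (QuotN N)} {z : QuotN N}
    (hz : IsLUB (K : Set (QuotN N)) z) : joinInv K = (scale z)⁻¹ := by
  let := partialOrder h
  have hex : ∃ q, IsLUB (K : Set (QuotN N)) q := ⟨z, hz⟩
  rw [joinInv, dif_pos hex, hex.choose_spec.unique hz]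

lemma joinInv_of_not (K : Finset (QuotN N)) (hK : ¬ ∃ q, IsLUB (K : Set (QuotN N)) q) :
    joinInv K = 0 := dif_neg hK

open Classical in
lemma joinInv_image_act [IsLeftCancelMul S] (h : N.KerOre) (a : S) {K : Finset (QuotN N)}
    (hK : K.Nonempty) : joinInv (K.image (act a)) = (N a)⁻¹ * joinInv K := by
  by_cases hq : ∃ q, IsLUB (K : Set (QuotN N)) q
  · obtain ⟨q, hq⟩ := hq
    rw [joinInv_of_isLUB h hq, joinInv_of_isLUB h (z := act a q), scale_act, mul_inv]
    rw [Finset.coe_image]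
    exact (isLUB_act h hK).2 hq
  · rw [joinInv_of_not K hq, joinInv_of_not, mul_zero]
    rintro ⟨z, hz⟩
    rw [Finset.coe_image] at hz
    obtain ⟨y, rfl⟩ := exists_eq_act_of_isLUB h hK hz
    exact hq ⟨y, (isLUB_act h hK).1 hz⟩

end QuotN

/-! ### The measure on join-closed order ideals of `S/∼_N` -/

namespace QuotN

variable {S : Type*} [Monoid S] {N : Scale S}

/-- Nonempty lower sets that are closed under joins, in which all joins exist. -/
structure IsJoinIdeal (H : Set (QuotN N)) : Prop where
  one_mem : mk N 1 ∈ H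
  lower : ∀ x y, x ≤ y → y ∈ H → x ∈ H
  join : ∀ x ∈ H, ∀ y ∈ H, ∃ z ∈ H, IsLUB {x, y} z

lemma IsJoinIdeal.exists_isLUB (h : N.KerOre) {H : Set (QuotN N)} (hH : IsJoinIdeal H)
    {F : Finset (QuotN N)} (hF : F.Nonempty) (hFH : (F : Set (QuotN N)) ⊆ H) :
    ∃ z ∈ H, IsLUB (F : Set (QuotN N)) z := by
  classical
  let := partialOrder h
  induction hF using Finset.Nonempty.cons_induction with
  | singleton a => exact ⟨a, hFH (by simp), by simp⟩
  | cons a s ha hs ih =>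
    rw [Finset.cons_eq_insert, Finset.coe_insert] at hFH ⊢
    obtain ⟨y, hyH, hy⟩ := ih ((Set.subset_insert _ _).trans hFH)
    obtain ⟨z, hzH, hz⟩ := hH.join a (hFH (Set.mem_insert _ _)) y hyH
    exact ⟨z, hzH, isLUB_insert h hy hz⟩

lemma IsJoinIdeal.mem_of_isLUB (h : N.KerOre) {H : Set (QuotN N)} (hH : IsJoinIdeal H)
    {F : Finset (QuotN N)} (hF : F.Nonempty) (hFH : (F : Set (QuotN N)) ⊆ H) {z : QuotN N}
    (hz : IsLUB (F : Set (QuotN N)) z) : z ∈ H := by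
  let := partialOrder h
  obtain ⟨w, hw, hw'⟩ := hH.exists_isLUB h hF hFH
  exact hz.unique hw' ▸ hw

lemma IsJoinIdeal.mem_of_isLUB_pair (h : N.KerOre) {H : Set (QuotN N)} (hH : IsJoinIdeal H)
    {x y z : QuotN N} (hx : x ∈ H) (hy : y ∈ H) (hz : IsLUB {x, y} z) : z ∈ H := by
  let := partialOrder h
  obtain ⟨w, hw, hw'⟩ := hH.join x hx y hy
  exact hz.unique hw' ▸ hw

lemma IsJoinIdeal.preimage [IsLeftCancelMul S] (h : N.KerOre) {H : Set (QuotN N)}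
    (hH : IsJoinIdeal H) {a : S} (ha : QuotN.mk N a ∈ H) : IsJoinIdeal (act a ⁻¹' H) where
  one_mem := by simpa using ha
  lower x y hxy hy := hH.lower _ _ ((act_le_act h).2 hxy) hy
  join x hx y hy := by
    obtain ⟨z, hz, hz'⟩ := hH.join _ hx _ hy
    rw [← Set.image_pair] at hz'
    obtain ⟨w, rfl⟩ := exists_eq_act_of_isLUB h (Set.insert_nonempty _ _) hz'
    exact ⟨w, hz, (isLUB_act h (Set.insert_nonempty _ _)).1 hz'⟩

/-- Probability measures on the join ideals giving `{H | x ∈ H}` the mass `N(x)⁻¹`. -/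
structure IsSpectral (ν : Measure (Set (QuotN N))) : Prop where
  prob : IsProbabilityMeasure ν
  apply_mem : ∀ x, ν {H | x ∈ H} = ENNReal.ofReal (scale x)⁻¹
  ae_isJoinIdeal : ∀ᵐ H ∂ν, IsJoinIdeal H

lemma measurableSet_isJoinIdeal [Countable S] :
    MeasurableSet {H : Set (QuotN N) | IsJoinIdeal H} := by
  have : {H : Set (QuotN N) | IsJoinIdeal H} = {H | QuotN.mk N 1 ∈ H ∧
      (∀ x y, x ≤ y → y ∈ H → x ∈ H) ∧ ∀ x, x ∈ H → ∀ y, y ∈ H → ∃ z, z ∈ H ∧ IsLUB {x, y} z} := by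
    ext H
    exact ⟨fun h => ⟨h.1, h.2, h.3⟩, fun h => ⟨h.1, h.2.1, h.2.2⟩⟩
  rw [this, measurableSet_setOfPred]
  have hm (x : QuotN N) : Measurable fun H : Set (QuotN N) => x ∈ H := measurable_set_mem x
  refine (hm _).and (.and (.forall fun x => .forall fun y => ?_) (.forall fun x => ?_))
  · exact measurable_const.imp ((hm y).imp (hm x))
  · exact (hm x).imp (.forall fun y => (hm y).imp (.exists fun z => (hm z).and measurable_const))

lemma measurableSet_subset {α : Type*} (F : Finset α) :
    MeasurableSet {H : Set α | (F : Set α) ⊆ H} := by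
  have : {H : Set α | (F : Set α) ⊆ H} = ⋂ x ∈ F, {H : Set α | x ∈ H} := by
    ext H; simp [Set.subset_def]
  rw [this]
  exact Finset.measurableSet_biInter _ fun x _ => measurableSet_mem x

/-- A join ideal contains `F` exactly when it contains the join of `F`. If there is no join, no join
ideal contains `F`, which explains the value `0` of `joinInv`. -/
lemma IsSpectral.apply_subset {ν : Measure (Set (QuotN N))} (hν : IsSpectral ν) (h : N.KerOre)
    {F : Finset (QuotN N)} (hF : F.Nonempty) :
    ν {H | (F : Set (QuotN N)) ⊆ H} = ENNReal.ofReal (joinInv F) := by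
  by_cases hq : ∃ q, IsLUB (F : Set (QuotN N)) q
  · obtain ⟨q, hq⟩ := hq
    rw [joinInv_of_isLUB h hq, ← hν.apply_mem]
    refine measure_congr (Filter.eventuallyEq_set.2 ?_)
    filter_upwards [hν.ae_isJoinIdeal] with H hH
    exact ⟨fun hFH => hH.mem_of_isLUB h hF hFH hq, fun hqH x hx => hH.lower _ _ (hq.1 hx) hqH⟩
  · rw [joinInv_of_not F hq, ENNReal.ofReal_zero]
    refine measure_eq_zero_iff_ae_notMem.2 ?_
    filter_upwards [hν.ae_isJoinIdeal] with H hH hFH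
    obtain ⟨z, -, hz⟩ := hH.exists_isLUB h hF hFH
    exact hq ⟨z, hz⟩

lemma joinInv_nonneg (K : Finset (QuotN N)) : 0 ≤ joinInv K := by
  rw [joinInv]
  split_ifs
  · exact inv_nonneg.2 (scale_pos _).le
  · exact le_rfl

lemma IsSpectral.altSum_eq {ν : Measure (Set (QuotN N))} (hν : IsSpectral ν) (h : N.KerOre)
    (F : Finset (QuotN N)) : altSum F = -ν.real {H | ∃ x ∈ F, x ∈ H} := by
  have := hν.prob
  have h1 : {H : Set (QuotN N) | ∃ x ∈ F, x ∈ H} = ⋃ x ∈ F, {H : Set (QuotN N) | x ∈ H} := by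
    ext H; simp
  rw [h1, measureReal_biUnion_eq_sum_powerset (fun x _ => measurableSet_mem x), altSum,
    ← Finset.sum_neg_distrib]
  refine Finset.sum_congr rfl fun K hK => ?_
  have h2 : ⋂ x ∈ K, {H : Set (QuotN N) | x ∈ H} = {H | (K : Set (QuotN N)) ⊆ H} := by
    ext H; simp [Set.subset_def]
  rw [h2, measureReal_def, hν.apply_subset h (Finset.mem_filter.1 hK).2,
    ENNReal.toReal_ofReal (joinInv_nonneg K), pow_succ]
  simp

lemma measurable_preimage {α β : Type*} (f : α → β) :
    Measurable fun H : Set β => f ⁻¹' H :=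
  measurable_set_iff.2 fun x => measurable_set_mem (f x)

/-- These sets form a π-system, so finite measures on `Set α` can be compared on them. -/
lemma generateFrom_subset (α : Type*) :
    (inferInstance : MeasurableSpace (Set α)) =
      MeasurableSpace.generateFrom
        (Set.range fun F : Finset α => {H : Set α | (F : Set α) ⊆ H}) := by
  refine le_antisymm ?_ (MeasurableSpace.generateFrom_le ?_)
  · let m := MeasurableSpace.generateFrom
      (Set.range fun F : Finset α => {H : Set α | (F : Set α) ⊆ H})
    have : @Measurable _ _ m Set.instMeasurableSpace (fun H : Set α => H) := by
      refine (@measurable_set_iff _ _ m _).2 fun x => ?_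
      refine (@measurableSet_setOfPred _ m _).1 (MeasurableSpace.measurableSet_generateFrom ⟨{x}, ?_⟩)
      ext H; simp
    intro s hs
    exact this hs
  · rintro _ ⟨F, rfl⟩
    exact measurableSet_subset F

/-- The measure scales under the action of `S`. -/
lemma IsSpectral.scaling [IsLeftCancelMul S] {ν : Measure (Set (QuotN N))} (hν : IsSpectral ν)
    (h : N.KerOre) (a : S) {E : Set (Set (QuotN N))} (hE : MeasurableSet E) :
    ν {H | QuotN.mk N a ∈ H ∧ act a ⁻¹' H ∈ E} = ENNReal.ofReal (N a)⁻¹ * ν E := by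
  classical
  have := hν.prob
  have hm := measurable_preimage (act (N := N) a)
  suffices (ν.restrict {H | QuotN.mk N a ∈ H}).map (fun H => act a ⁻¹' H) =
      ENNReal.ofReal (N a)⁻¹ • ν by
    have h2 := congrArg (fun μ : Measure _ => μ E) this
    simp only [Measure.map_apply hm hE, Measure.restrict_apply (hm hE), Measure.smul_apply,
      smul_eq_mul] at h2
    rw [← h2]
    congr 1
    ext H
    exact and_comm
  have huniv : ν {H | QuotN.mk N a ∈ H} = ENNReal.ofReal (N a)⁻¹ := hν.apply_mem _
  have : IsFiniteMeasure (ν.restrict {H | QuotN.mk N a ∈ H}) := inferInstance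
  refine ext_of_generate_finite _ (generateFrom_subset (QuotN N)) ?_ ?_ ?_
  · rintro _ ⟨F, rfl⟩ _ ⟨G, rfl⟩ -
    refine ⟨F ∪ G, ?_⟩
    ext H; simp
  · rintro _ ⟨F, rfl⟩
    rw [Measure.map_apply hm (measurableSet_subset F),
      Measure.restrict_apply (hm (measurableSet_subset F)), Measure.smul_apply, smul_eq_mul]
    obtain rfl | hF := F.eq_empty_or_nonempty
    · simp [huniv]
    · rw [hν.apply_subset h hF, ← ENNReal.ofReal_mul (inv_nonneg.2 (N.pos a).le),
        ← joinInv_image_act h a hF, ← hν.apply_subset h (hF.image _)]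
      refine measure_congr (Filter.eventuallyEq_set.2 ?_)
      filter_upwards [hν.ae_isJoinIdeal] with H hH
      simp only [Set.mem_inter_iff, Set.mem_preimage, Set.mem_ofPred_eq, Finset.coe_image,
        Set.image_subset_iff]
      -- For nonempty `F` the condition `[a] ∈ H` is automatic, because `H` is a lower set and every
      -- `act a x` lies above `[a]`.
      refine ⟨fun hH => hH.1, fun hFH => ⟨hFH, ?_⟩⟩
      obtain ⟨x, hx⟩ := hF
      exact hH.lower _ _ (mk_le_act a x) (hFH hx)
  · rw [Measure.map_apply hm .univ, Set.preimage_univ, Measure.restrict_apply .univ,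
      Set.univ_inter, huniv, Measure.smul_apply, measure_univ, smul_eq_mul, mul_one]

end QuotN

/-! ### Spectral models -/

/-- A probability space with measurable sets `Z_s` of measure `N(s)⁻¹` that intersect in the same
way as the right ideals `sS`. -/
structure IsModel {S : Type*} [Monoid S] (N : Scale S) {X : Type*} [MeasurableSpace X]
    (μ : Measure X) (W : S → Set X) : Prop where
  prob : IsProbabilityMeasure μ
  meas : ∀ s, MeasurableSet (W s)
  apply : ∀ s, μ (W s) = ENNReal.ofReal (N s)⁻¹
  inter : ∀ s t r, rightIdeal s ∩ rightIdeal t = rightIdeal r → W s ∩ W t = W r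
  disj : ∀ s t, rightIdeal s ∩ rightIdeal t = ∅ → W s ∩ W t = ∅

namespace IsModel

variable {S : Type*} [Monoid S] {N : Scale S} {X : Type*} [MeasurableSpace X]
  {μ : Measure X} {W : S → Set X}

lemma scale_eq_of_measure_eq (hW : IsModel N μ W) {s t : S} (h : μ (W s) = μ (W t)) :
    N s = N t := by
  rw [hW.apply, hW.apply, ENNReal.ofReal_eq_ofReal_iff (inv_nonneg.2 (N.pos s).le)
    (inv_nonneg.2 (N.pos t).le)] at h
  exact inv_inj.1 h

/-- For `c ∈ ker N` the set `W c` has full measure, so `W x ∩ W c` has the positive measure of `W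
x`. Hence `xS` and `cS` meet, and their least common multiple `x * y` has the same scale as `x`. -/
lemma kerOre (hS : IsRightLCM S) (hW : IsModel N μ W) : N.KerOre := by
  intro c hc x
  have := hW.prob
  have h1 : μ (W c)ᶜ = 0 := by
    rw [prob_compl_eq_zero_iff (hW.meas c), hW.apply, N.mem_ker.1 hc]
    simp
  have h2 : μ (W x ∩ W c) = μ (W x) := measure_inter_conull h1
  have h3 : (rightIdeal x ∩ rightIdeal c).Nonempty := by
    by_contra h
    rw [hW.disj _ _ (Set.not_nonempty_iff_eq_empty.1 h), measure_empty, hW.apply] at h2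
    have := ENNReal.ofReal_eq_zero.1 h2.symm
    have := inv_pos.2 (N.pos x)
    linarith
  obtain ⟨y, z, e, he⟩ := hS.exists_lcm h3
  refine ⟨y, ?_, z, e⟩
  rw [hW.inter _ _ _ he] at h2
  have h4 := hW.scale_eq_of_measure_eq h2
  rw [N.map_mul] at h4
  exact N.mem_ker.2 (mul_left_cancel₀ (N.pos x).ne' (by rw [h4, mul_one]))

lemma mono (hW : IsModel N μ W) {s t : S} (h : t ∈ rightIdeal s) : W t ⊆ W s := by
  have := hW.inter s t t (Set.inter_eq_right.2 (rightIdeal_subset h))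
  rw [← this]
  exact Set.inter_subset_left

lemma ae_mem_iff_mul (hW : IsModel N μ W) (s : S) {a : S} (ha : a ∈ N.ker) :
    W (s * a) =ᵐ[μ] W s := by
  have := hW.prob
  refine ae_eq_of_subset_of_measure_ge (hW.mono ⟨a, rfl⟩) ?_ (hW.meas _).nullMeasurableSet
    (measure_ne_top _ _)
  rw [hW.apply, hW.apply, N.map_mul, N.mem_ker.1 ha, mul_one]

lemma ae_mem_iff (h : N.KerOre) (hW : IsModel N μ W) {s t : S}
    (hst : QuotN.mk N s = QuotN.mk N t) : W s =ᵐ[μ] W t := by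
  obtain ⟨a, ha, b, hb, e⟩ := (QuotN.mk_eq_mk h).1 hst
  exact (hW.ae_mem_iff_mul s ha).symm.trans (e ▸ hW.ae_mem_iff_mul t hb)

-- A point `χ` is sent to the set of classes `[s]` with `χ ∈ W s`. Equivalent elements have almost
-- equal sets `W s`, and `S` is countable, so off one null set the choice of representatives does
-- not matter.
open QuotN in
lemma exists_isSpectral [Countable S] (hS : IsRightLCM S) (hW : IsModel N μ W) :
    ∃ ν : Measure (Set (QuotN N)), IsSpectral ν := by
  have := hW.prob
  have h := hW.kerOre hS
  choose rep hrep using exists_rep (N := N)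
  let g : X → Set (QuotN N) := fun χ => {x | χ ∈ W (rep x)}
  have hg : Measurable g := measurable_set_iff.2 fun x => measurableSet_setOfPred.1 (hW.meas (rep x))
  have hae : ∀ᵐ χ ∂μ, ∀ s, QuotN.mk N s ∈ g χ ↔ χ ∈ W s := by
    refine ae_all_iff.2 fun s => ?_
    exact Filter.eventuallyEq_set.1 (hW.ae_mem_iff h (hrep (QuotN.mk N s)))
  have hone : ∀ᵐ χ ∂μ, χ ∈ W 1 := by
    refine (prob_compl_eq_zero_iff (hW.meas 1)).2 ?_
    rw [hW.apply, N.toHom.map_one]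
    simp
  refine ⟨μ.map g, Measure.isProbabilityMeasure_map hg.aemeasurable, fun x => ?_, ?_⟩
  · rw [Measure.map_apply hg (measurableSet_mem x)]
    obtain ⟨s, rfl⟩ := exists_rep x
    rw [scale_mk, ← hW.apply]
    refine measure_congr (Filter.eventuallyEq_set.2 ?_)
    filter_upwards [hae] with χ hχ using hχ s
  · have : ∀ᵐ χ ∂μ, IsJoinIdeal (g χ) := by
      filter_upwards [hae, hone] with χ hχ h1
      refine ⟨(hχ 1).2 h1, fun x y hxy hy => ?_, fun x hx y hy => ?_⟩
      · obtain ⟨s, rfl⟩ := exists_rep x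
        obtain ⟨t, rfl⟩ := exists_rep y
        obtain ⟨u, hu, hus⟩ := exists_common_of_le h hxy ((partialOrder h).le_refl _)
        rw [← hu, hχ] at hy
        exact (hχ s).2 (hW.mono hus.1 hy)
      · obtain ⟨s, rfl⟩ := exists_rep x
        obtain ⟨t, rfl⟩ := exists_rep y
        rw [hχ] at hx hy
        obtain he | ⟨r, hr⟩ := hS s t
        · exact absurd (hW.disj s t he) (Set.Nonempty.ne_empty ⟨χ, hx, hy⟩)
        · exact ⟨QuotN.mk N r, (hχ r).2 (hW.inter s t r hr ▸ ⟨hx, hy⟩), isLUB_mk h hr⟩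
    exact (ae_map_iff hg.aemeasurable measurableSet_isJoinIdeal).2 this

end IsModel

/-! ### The numbers `A(a,b)` and `Φ(a,b)` -/

namespace QuotN

variable {S : Type*} [Monoid S] {N : Scale S}

variable (N) in
/-- The join ideals that meet `B^{a,b}`. -/
def trivSet (a b : S) : Set (Set (QuotN N)) := {H | ∃ x ∈ B N a b, x ∈ H}

variable (N) in
/-- The join ideals that contain `[a]` and `[b]` and have the same translates by `a` and `b`. -/
def fixSet (a b : S) : Set (Set (QuotN N)) :=
  {H | mk N a ∈ H ∧ mk N b ∈ H ∧ ∀ x, act a x ∈ H ↔ act b x ∈ H}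

/-- The join ideals whose largest element in `F` belongs to `T^{a,b}_F`. -/
def cellSet (a b : S) (F : Finset (QuotN N)) : Set (Set (QuotN N)) :=
  ⋃ x ∈ T a b F, {H | x ∈ H ∧ ∀ r ∈ above F x, r ∉ H}

lemma measurableSet_trivSet [Countable S] (a b : S) : MeasurableSet (trivSet N a b) := by
  have : trivSet N a b = ⋃ x ∈ B N a b, {H | x ∈ H} := by ext H; simp [trivSet]
  rw [this]
  exact .biUnion (Set.to_countable _) fun x _ => measurableSet_mem x

lemma measurableSet_fixSet [Countable S] (a b : S) : MeasurableSet (fixSet N a b) := by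
  rw [fixSet, measurableSet_setOfPred]
  exact (measurable_set_mem _).and ((measurable_set_mem _).and
    (.forall fun x => (measurable_set_mem _).iff (measurable_set_mem _)))

lemma measurableSet_cell (F : Finset (QuotN N)) (x : QuotN N) :
    MeasurableSet {H : Set (QuotN N) | x ∈ H ∧ ∀ r ∈ above F x, r ∉ H} := by
  have : {H : Set (QuotN N) | x ∈ H ∧ ∀ r ∈ above F x, r ∉ H} =
      {H | x ∈ H} ∩ ⋂ r ∈ above F x, {H | r ∈ H}ᶜ := by ext H; simp
  rw [this]
  exact (measurableSet_mem x).inter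
    (Finset.measurableSet_biInter _ fun r _ => (measurableSet_mem r).compl)

lemma measurableSet_cellSet (a b : S) (F : Finset (QuotN N)) : MeasurableSet (cellSet a b F) :=
  Finset.measurableSet_biUnion _ fun x _ => measurableSet_cell F x

lemma mem_above {F : Finset (QuotN N)} {x r : QuotN N} :
    r ∈ above F x ↔ r ∈ F ∧ x ≤ r ∧ r ≠ x := by
  classical
  simp [above]

lemma mem_T {a b : S} {F : Finset (QuotN N)} {x : QuotN N} :
    x ∈ T a b F ↔ x ∈ F ∧ ∃ y : QuotN N, x ≤ act a y ∧ x ≤ act b y ∧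
      ∀ r ∈ above F x, ¬ r ≤ act a y ∧ ¬ r ≤ act b y := by
  classical
  simp [T]

lemma mem_cellSet {a b : S} {F : Finset (QuotN N)} {H : Set (QuotN N)} :
    H ∈ cellSet a b F ↔ ∃ x ∈ T a b F, x ∈ H ∧ ∀ r ∈ above F x, r ∉ H := by
  simp only [cellSet, Set.mem_iUnion, Set.mem_ofPred_eq, exists_prop]

/-! ### Join-closed finite sets and the largest element of a join ideal in them -/

/-- `∨`-closed finite sets. -/
def JoinClosed (F : Finset (QuotN N)) : Prop :=
  ∀ x ∈ F, ∀ y ∈ F, ∀ z, IsLUB {x, y} z → z ∈ F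

/-- The `∨`-closure of a finite set is finite. -/
lemma exists_joinClosed (h : N.KerOre) (F : Finset (QuotN N)) :
    ∃ C : Finset (QuotN N), F ⊆ C ∧ (∀ z ∈ C, ∃ x ∈ F, x ≤ z) ∧ JoinClosed C := by
  classical
  let := partialOrder h
  let P : Set (QuotN N) := {z | ∃ K ⊆ F, K.Nonempty ∧ IsLUB (K : Set (QuotN N)) z}
  have hP : P.Finite := by
    refine (F.powerset.finite_toSet.biUnion
      (t := fun K => {z | IsLUB (K : Set (QuotN N)) z}) fun K _ => ?_).subset ?_
    · exact Set.Subsingleton.finite fun z hz w hw => hz.unique hw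
    · rintro z ⟨K, hK, -, hz⟩
      exact Set.mem_biUnion (Finset.mem_coe.2 (Finset.mem_powerset.2 hK)) hz
  refine ⟨hP.toFinset, fun x hx => ?_, fun z hz => ?_, fun x hx y hy z hz => ?_⟩
  · exact hP.mem_toFinset.2 ⟨{x}, by simpa using hx, by simp, by simp⟩
  · obtain ⟨K, hK, ⟨x, hx⟩, hz⟩ := hP.mem_toFinset.1 hz
    exact ⟨x, hK hx, hz.1 hx⟩
  · obtain ⟨K, hK, hKn, hx⟩ := hP.mem_toFinset.1 hx
    obtain ⟨L, hL, -, hy⟩ := hP.mem_toFinset.1 hy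
    refine hP.mem_toFinset.2 ⟨K ∪ L, Finset.union_subset hK hL, hKn.mono Finset.subset_union_left, ?_⟩
    rw [isLUB_pair_iff] at hz
    rw [Finset.coe_union]
    refine ⟨?_, fun w hw => hz.2.2 w (hx.2 fun v hv => hw (.inl hv)) (hy.2 fun v hv => hw (.inr hv))⟩
    rintro v (hv | hv)
    · exact (hx.1 hv).trans hz.1
    · exact (hy.1 hv).trans hz.2.1

lemma IsJoinIdeal.exists_max (h : N.KerOre) {H : Set (QuotN N)} (hH : IsJoinIdeal H)
    {F : Finset (QuotN N)} (hF : JoinClosed F) {m : QuotN N} (hm : m ∈ F) (hmH : m ∈ H) :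
    ∃ x ∈ F, x ∈ H ∧ ∀ y ∈ F, y ∈ H → y ≤ x := by
  classical
  let := partialOrder h
  obtain ⟨x, hx⟩ := (F.filter (· ∈ H)).exists_maximal ⟨m, by simp [hm, hmH]⟩
  have hx' := Finset.mem_filter.1 hx.1
  refine ⟨x, hx'.1, hx'.2, fun y hy hyH => ?_⟩
  obtain ⟨z, hzH, hz⟩ := hH.join x hx'.2 y hyH
  have hz' := isLUB_pair_iff.1 hz
  exact hz'.2.1.trans (hx.2 (Finset.mem_filter.2 ⟨hF x hx'.1 y hy z hz, hzH⟩) hz'.1)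

lemma IsJoinIdeal.le_of_forall_above (h : N.KerOre) {H : Set (QuotN N)} (hH : IsJoinIdeal H)
    {F : Finset (QuotN N)} (hF : JoinClosed F) {x y : QuotN N} (hx : x ∈ F) (hxH : x ∈ H)
    (hxa : ∀ r ∈ above F x, r ∉ H) (hy : y ∈ F) (hyH : y ∈ H) : y ≤ x := by
  let := partialOrder h
  obtain ⟨z, hzH, hz⟩ := hH.join x hxH y hyH
  have hz' := isLUB_pair_iff.1 hz
  by_contra hyx
  exact hxa z (mem_above.2 ⟨hF x hx y hy z hz, hz'.1, fun e => hyx (e ▸ hz'.2.1)⟩) hzH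

namespace IsSpectral

variable {ν : Measure (Set (QuotN N))}

/-- Almost every `H` is a lower set, so `{H | x ∈ H}` is the disjoint union of the cell of `x` and
the event that `H` meets `above F x`, up to a null set. -/
lemma real_cell (hν : IsSpectral ν) (h : N.KerOre) (F : Finset (QuotN N)) (x : QuotN N) :
    (scale x)⁻¹ + altSum (above F x) =
      ν.real {H : Set (QuotN N) | x ∈ H ∧ ∀ r ∈ above F x, r ∉ H} := by
  have := hν.prob
  have h1 : ν.real {H | x ∈ H} = (scale x)⁻¹ := by
    rw [measureReal_def, hν.apply_mem, ENNReal.toReal_ofReal (inv_nonneg.2 (scale_pos x).le)]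
  have hm : MeasurableSet {H : Set (QuotN N) | ∃ r ∈ above F x, r ∈ H} := by
    have : {H : Set (QuotN N) | ∃ r ∈ above F x, r ∈ H} =
      ⋃ r ∈ above F x, {H : Set (QuotN N) | r ∈ H} := by ext H; simp
    rw [this]
    exact Finset.measurableSet_biUnion _ fun r _ => measurableSet_mem r
  have h2 : ν.real {H | x ∈ H} = ν.real ({H : Set (QuotN N) | x ∈ H ∧ ∀ r ∈ above F x, r ∉ H} ∪
      {H | ∃ r ∈ above F x, r ∈ H}) := by
    refine measureReal_congr (Filter.eventuallyEq_set.2 ?_)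
    filter_upwards [hν.ae_isJoinIdeal] with H hH
    simp only [Set.mem_ofPred_eq, Set.mem_union]
    constructor
    · intro hx
      by_cases hr : ∃ r ∈ above F x, r ∈ H
      · exact .inr hr
      · push Not at hr
        exact .inl ⟨hx, hr⟩
    · rintro (hx | ⟨r, hr, hrH⟩)
      · exact hx.1
      · exact hH.lower _ _ (mem_above.1 hr).2.1 hrH
  rw [measureReal_union _ hm, h1] at h2
  · rw [hν.altSum_eq h, h2, add_neg_cancel_right]
  · refine Set.disjoint_left.2 ?_
    rintro H ⟨-, h3⟩ ⟨r, hr, hrH⟩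
    exact h3 r hr hrH

/-- Cells of different elements are almost disjoint, since the label of a cell is the largest
element of `H` in `F`. -/
lemma sum_T (hν : IsSpectral ν) (h : N.KerOre) (a b : S) {F : Finset (QuotN N)}
    (hF : JoinClosed F) :
    ∑ x ∈ T a b F, ((scale x)⁻¹ + altSum (above F x)) = ν.real (cellSet a b F) := by
  have := hν.prob
  rw [cellSet, measureReal_biUnion_finset₀ (μ := ν) _
    (fun x _ => (measurableSet_cell F x).nullMeasurableSet)]
  · exact Finset.sum_congr rfl fun x _ => hν.real_cell h F x
  · intro x hx y hy hxy
    refine measure_eq_zero_iff_ae_notMem.2 ?_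
    filter_upwards [hν.ae_isJoinIdeal] with H hH
    rintro ⟨⟨hxH, hxa⟩, hyH, hya⟩
    let := partialOrder h
    have hx' := (mem_T.1 hx).1
    have hy' := (mem_T.1 hy).1
    exact hxy (le_antisymm (hH.le_of_forall_above h hF hy' hyH hya hx' hxH)
      (hH.le_of_forall_above h hF hx' hxH hxa hy' hyH))

end IsSpectral

/-- The witness `y` for the larger set also serves the smaller one. If `r ∈ F` lies below a
translate of `y`, then so does the join of `r` with the largest element `x'` of `H` in `G`.
Maximality in `T` forces this join to be `x'`, so `r ≤ x'` and `r ∈ H`. -/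
lemma IsJoinIdeal.mem_cellSet_anti (hS : IsRightLCM S) (h : N.KerOre) {H : Set (QuotN N)}
    (hH : IsJoinIdeal H) {a b : S} {F G : Finset (QuotN N)} (hFG : F ⊆ G) (hF : JoinClosed F)
    (hG : JoinClosed G) {m : QuotN N} (hm : m ∈ F) (hmG : ∀ x ∈ G, m ≤ x)
    (hHG : H ∈ cellSet a b G) : H ∈ cellSet a b F := by
  let := partialOrder h
  obtain ⟨x', hx', hx'H, hx'a⟩ := mem_cellSet.1 hHG
  obtain ⟨hx'G, y, hya, hyb, hy⟩ := mem_T.1 hx'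
  obtain ⟨x, hxF, hxH, hx⟩ := hH.exists_max h hF hm (hH.lower _ _ (hmG x' hx'G) hx'H)
  have hxx' : x ≤ x' := hH.le_of_forall_above h hG hx'G hx'H hx'a (hFG hxF) hxH
  have key : ∀ c, x' ≤ act c y → (∀ r ∈ above G x', ¬ r ≤ act c y) →
      ∀ r ∈ above F x, ¬ r ≤ act c y := by
    intro c hc hcr r hr hrc
    obtain ⟨hrF, hxr, hne⟩ := mem_above.1 hr
    obtain ⟨z, hz⟩ := exists_isLUB_pair hS h hc hrc
    have hz' := isLUB_pair_iff.1 hz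
    have hzG := hG x' hx'G r (hFG hrF) z hz
    have hzx : z = x' := by
      by_contra hne
      exact hcr z (mem_above.2 ⟨hzG, hz'.1, hne⟩) (hz'.2.2 _ hc hrc)
    exact hne (le_antisymm (hx r hrF (hH.lower _ _ (hzx ▸ hz'.2.1) hx'H)) hxr)
  refine mem_cellSet.2 ⟨x, mem_T.2 ⟨hxF, y, hxx'.trans hya, hxx'.trans hyb, fun r hr =>
    ⟨key a hya (fun r hr => (hy r hr).1) r hr, key b hyb (fun r hr => (hy r hr).2) r hr⟩⟩,
    hxH, fun r hr hrH => ?_⟩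
  obtain ⟨hrF, hxr, hne⟩ := mem_above.1 hr
  exact hne (le_antisymm (hx r hrF hrH) hxr)

/-- Membership in a cell means that, as far as `F` can see, `H` looks like the principal ideal below
`act a y` and also like the one below `act b y`. -/
lemma IsJoinIdeal.exists_of_mem_cellSet (hS : IsRightLCM S) (h : N.KerOre) {H : Set (QuotN N)}
    (hH : IsJoinIdeal H) {a b : S} {F : Finset (QuotN N)} (hF : JoinClosed F)
    (hHF : H ∈ cellSet a b F) :
    ∃ y, ∀ z ∈ F, (z ∈ H ↔ z ≤ act a y) ∧ (z ∈ H ↔ z ≤ act b y) := by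
  let := partialOrder h
  obtain ⟨x, hx, hxH, hxa⟩ := mem_cellSet.1 hHF
  obtain ⟨hxF, y, hya, hyb, hy⟩ := mem_T.1 hx
  have key : ∀ c, x ≤ act c y → (∀ r ∈ above F x, ¬ r ≤ act c y) → ∀ z ∈ F,
      (z ∈ H ↔ z ≤ act c y) := by
    intro c hc hcr z hz
    refine ⟨fun hzH => (hH.le_of_forall_above h hF hxF hxH hxa hz hzH).trans hc, fun hzc => ?_⟩
    obtain ⟨w, hw⟩ := exists_isLUB_pair hS h hc hzc
    have hw' := isLUB_pair_iff.1 hw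
    have hwx : w = x := by
      by_contra hne
      exact hcr w (mem_above.2 ⟨hF x hxF z hz w hw, hw'.1, hne⟩) (hw'.2.2 _ hc hzc)
    exact hH.lower _ _ (hwx ▸ hw'.2.1) hxH
  exact ⟨y, fun z hz => ⟨key a hya (fun r hr => (hy r hr).1) z hz,
    key b hyb (fun r hr => (hy r hr).2) z hz⟩⟩

/-- A join ideal that is approximately fixed at all finite levels is fixed: one implication. -/
lemma IsJoinIdeal.act_mem_of_act_mem [IsLeftCancelMul S] (hS : IsRightLCM S) (h : N.KerOre)
    {H : Set (QuotN N)} (hH : IsJoinIdeal H) {a b : S} {m : QuotN N} (ham : QuotN.mk N a ≤ m)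
    (hmH : m ∈ H)
    (hy : ∀ C : Finset (QuotN N), (∀ z ∈ C, m ≤ z) →
      ∃ y, ∀ z ∈ C, (z ∈ H ↔ z ≤ act a y) ∧ (z ∈ H ↔ z ≤ act b y))
    {x : QuotN N} (hx : act a x ∈ H) : act b x ∈ H := by
  classical
  let := partialOrder h
  -- Only elements above `m` may be tested, so `act a x` is replaced by its join `w` with `m`. From
  -- `w ≤ act a y` cancellation gives `x ≤ y`, hence `act b x ≤ act b y`.
  obtain ⟨w, hwH, hw⟩ := hH.join _ hx m hmH
  have hw' := isLUB_pair_iff.1 hw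
  have key : ∀ C : Finset (QuotN N), (∀ z ∈ C, m ≤ z) → ∃ y, act b x ≤ act b y ∧ m ≤ act b y ∧
      ∀ z ∈ C, z ∈ H ↔ z ≤ act b y := by
    intro C hC
    obtain ⟨y, hy⟩ := hy (insert m (insert w C)) (by
      intro z hz
      simp only [Finset.mem_insert] at hz
      obtain rfl | rfl | hz := hz
      · exact le_rfl
      · exact hw'.2.1
      · exact hC z hz)
    have h1 : w ≤ act a y := (hy w (by simp)).1.1 hwH
    have h2 : act b x ≤ act b y := (act_le_act h).2 ((act_le_act h).1 (hw'.1.trans h1))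
    exact ⟨y, h2, (hy m (by simp)).2.1 hmH, fun z hz => (hy z (by simp [hz])).2⟩
  obtain ⟨y, hy1, hy2, -⟩ := key ∅ (by simp)
  -- The first witness `y` only shows that `act b x` and `m` have a join `v`. A second witness,
  -- obtained with `v` as a test element, puts `v` into `H`.
  obtain ⟨v, hv⟩ := exists_isLUB_pair hS h hy1 hy2
  have hv' := isLUB_pair_iff.1 hv
  obtain ⟨y', hy1', hy2', hy3'⟩ := key {v} (by simpa using hv'.2.1)
  exact hH.lower _ _ hv'.1 ((hy3' v (by simp)).2 (hv'.2.2 _ hy1' hy2'))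

/-! ### Directedness of the index sets of the two limits -/

section Index

variable {a b : S}

instance : IsDirectedOrder (TrivIndex N a b) := ⟨fun F G => by
  classical
  refine ⟨⟨F.1 ∪ G.1, ?_⟩, ?_, ?_⟩
  · rw [Finset.coe_union]
    exact Set.union_subset F.2 G.2
  · exact (Finset.subset_union_left : F.1 ⊆ _)
  · exact (Finset.subset_union_right : G.1 ⊆ _)⟩

instance : Nonempty (TrivIndex N a b) := ⟨⟨∅, by simp⟩⟩

lemma exists_fixIndex (h : N.KerOre) {m : QuotN N} (hm : IsLUB {mk N a, mk N b} m)
    (C : Finset (QuotN N)) (hC : ∀ z ∈ C, m ≤ z) : ∃ F : FixIndex N a b, C ⊆ F.1 := by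
  classical
  let := partialOrder h
  obtain ⟨F, hF, hF', hFj⟩ := exists_joinClosed h (insert m C)
  refine ⟨⟨F, ⟨m, hm, hF (by simp), fun x hx => ?_⟩, hFj⟩, (Finset.subset_insert _ _).trans hF⟩
  obtain ⟨y, hy, hyx⟩ := hF' x hx
  obtain rfl | hy := Finset.mem_insert.1 hy
  · exact hyx
  · exact (hC y hy).trans hyx

lemma isDirectedOrder_fixIndex (h : N.KerOre) : IsDirectedOrder (FixIndex N a b) := ⟨fun F G => by
  classical
  let := partialOrder h
  obtain ⟨m, hm, hmF, hF⟩ := F.2.1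
  obtain ⟨m', hm', hmG, hG⟩ := G.2.1
  obtain rfl := hm.unique hm'
  obtain ⟨K, hK⟩ := exists_fixIndex h hm (F.1 ∪ G.1) (by
    intro z hz
    obtain hz | hz := Finset.mem_union.1 hz
    · exact hF z hz
    · exact hG z hz)
  exact ⟨K, Finset.subset_union_left.trans hK, Finset.subset_union_right.trans hK⟩⟩

end Index

/-! ### The two limits as measures of events -/

namespace IsSpectral

variable {ν : Measure (Set (QuotN N))}

lemma isTrivNumber [Countable S] (hν : IsSpectral ν) (h : N.KerOre) (a b : S) :
    IsTrivNumber N a b (ν.real (trivSet N a b)) := by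
  have := hν.prob
  have hmono : Monotone fun F : TrivIndex N a b => {H : Set (QuotN N) | ∃ x ∈ F.1, x ∈ H} :=
    fun F G hFG H ⟨x, hx, hxH⟩ => ⟨x, hFG hx, hxH⟩
  have hU : ⋃ F : TrivIndex N a b, {H : Set (QuotN N) | ∃ x ∈ F.1, x ∈ H} = trivSet N a b := by
    ext H
    simp only [Set.mem_iUnion, Set.mem_ofPred_eq, trivSet]
    constructor
    · rintro ⟨F, x, hx, hxH⟩
      exact ⟨x, F.2 hx, hxH⟩
    · rintro ⟨x, hx, hxH⟩
      exact ⟨⟨{x}, by simpa using hx⟩, x, by simp, hxH⟩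
  have h1 := tendsto_measure_iUnion_atTop (μ := ν) hmono
  rw [hU] at h1
  have h2 := (ENNReal.tendsto_toReal (measure_ne_top ν _)).comp h1
  refine h2.congr fun F => ?_
  rw [hν.altSum_eq h, neg_neg]
  rfl

/-- Each approximating sum is the measure of a `cellSet`. Restricted to join ideals these sets
decrease along the index set, and their intersection is `fixSet`, so continuity from above applies.
-/
lemma isFixNumber [IsLeftCancelMul S] [Countable S] (hS : IsRightLCM S) (hν : IsSpectral ν)
    (h : N.KerOre) {a b : S} {m : QuotN N} (hm : IsLUB {QuotN.mk N a, QuotN.mk N b} m) :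
    IsFixNumber N a b (ν.real (fixSet N a b)) := by
  have := hν.prob
  let := partialOrder h
  have hm' := isLUB_pair_iff.1 hm
  let G : Set (Set (QuotN N)) := {H | IsJoinIdeal H}
  have hG : ∀ E : Set (Set (QuotN N)), ν (E ∩ G) = ν E := fun E =>
    measure_inter_conull hν.ae_isJoinIdeal
  have hanti : Antitone fun F : FixIndex N a b => cellSet a b F.1 ∩ G := by
    rintro F F' hFF H ⟨hH, hHG⟩
    obtain ⟨n, hn, hnF, -⟩ := F.2.1
    obtain ⟨n', hn', -, hF'⟩ := F'.2.1
    obtain rfl := hn.unique hn'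
    exact ⟨IsJoinIdeal.mem_cellSet_anti hS h hHG hFF F.2.2 F'.2.2 hnF hF' hH, hHG⟩
  obtain ⟨F₀, -⟩ := exists_fixIndex h hm ∅ (by simp)
  have hI : ⋂ F : FixIndex N a b, (cellSet a b F.1 ∩ G) = fixSet N a b ∩ G := by
    ext H
    simp only [Set.mem_iInter, Set.mem_inter_iff]
    constructor
    · intro hH
      have hHG : IsJoinIdeal H := (hH F₀).2
      refine ⟨?_, hHG⟩
      have hy : ∀ C : Finset (QuotN N), (∀ z ∈ C, m ≤ z) →
          ∃ y, ∀ z ∈ C, (z ∈ H ↔ z ≤ act a y) ∧ (z ∈ H ↔ z ≤ act b y) := by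
        intro C hC
        obtain ⟨F, hF⟩ := exists_fixIndex h hm C hC
        obtain ⟨y, hy⟩ := hHG.exists_of_mem_cellSet hS h F.2.2 (hH F).1
        exact ⟨y, fun z hz => hy z (hF hz)⟩
      have hmH : m ∈ H := by
        obtain ⟨n, hn, -, hF⟩ := F₀.2.1
        obtain rfl := hm.unique hn
        obtain ⟨x, hx, hxH, -⟩ := mem_cellSet.1 (hH F₀).1
        exact hHG.lower _ _ (hF x (mem_T.1 hx).1) hxH
      exact ⟨hHG.lower _ _ hm'.1 hmH, hHG.lower _ _ hm'.2.1 hmH, fun x =>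
        ⟨hHG.act_mem_of_act_mem hS h hm'.1 hmH hy, hHG.act_mem_of_act_mem hS h hm'.2.1 hmH
          fun C hC => (hy C hC).imp fun y hy z hz => (hy z hz).symm⟩⟩
    · rintro ⟨⟨ha, hb, hab⟩, (hHG : IsJoinIdeal H)⟩ F
      refine ⟨?_, hHG⟩
      obtain ⟨n, hn, hnF, hF⟩ := F.2.1
      obtain rfl := hm.unique hn
      have hmH : m ∈ H := hHG.mem_of_isLUB_pair h ha hb hm
      obtain ⟨x, hxF, hxH, hx⟩ := hHG.exists_max h F.2.2 hnF hmH
      have hax := hm'.1.trans (hF x hxF)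
      have hbx := hm'.2.1.trans (hF x hxF)
      -- Write the largest element `x` of `H` in `F` as `act a p` and as `act b q`. Invariance puts
      -- both `p` and `q` into `act a ⁻¹' H`, and their join there is the witness `y` required by
      -- `T`.
      obtain ⟨p, hp⟩ := exists_act_of_le h hax
      obtain ⟨q, hq⟩ := exists_act_of_le h hbx
      have hpH : act a p ∈ H := hp ▸ hxH
      have hqH : act a q ∈ H := (hab q).2 (hq ▸ hxH)
      obtain ⟨y, hyH, hy⟩ := (hHG.preimage h ha).join p hpH q hqH
      have hy' := isLUB_pair_iff.1 hy
      have hyH' : act b y ∈ H := (hab y).1 hyH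
      have hr : ∀ r ∈ above F.1 x, r ∉ H := by
        intro r hr hrH
        obtain ⟨hrF, hxr, hne⟩ := mem_above.1 hr
        exact hne (le_antisymm (hx r hrF hrH) hxr)
      refine mem_cellSet.2 ⟨x, mem_T.2 ⟨hxF, y, ?_, ?_, fun r hrF => ⟨fun hle => ?_, fun hle => ?_⟩⟩,
        hxH, hr⟩
      · rw [hp]; exact (act_le_act h).2 hy'.1
      · rw [hq]; exact (act_le_act h).2 hy'.2.1
      · exact hr r hrF (hHG.lower _ _ hle hyH)
      · exact hr r hrF (hHG.lower _ _ hle hyH')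
  have h1 := tendsto_measure_iInter_atTop (μ := ν) (fun F : FixIndex N a b =>
    ((measurableSet_cellSet a b F.1).inter measurableSet_isJoinIdeal).nullMeasurableSet) hanti
    ⟨F₀, measure_ne_top _ _⟩
  rw [hI, hG] at h1
  have h2 := (ENNReal.tendsto_toReal (measure_ne_top ν _)).comp h1
  refine h2.congr fun F => ?_
  rw [hν.sum_T h a b F.2.2, measureReal_def, ← hG]
  rfl

end IsSpectral

/-! ### Reduction to the complements of a least common multiple -/

section Reduction

variable {a b p q : S}

/-- The relation `a * p = b * q` identifies `act a (act p u)` with `act b (act q u)`. Forwards,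
invariance is applied to `act q u`. Backwards, a general `x` is enlarged to its join with `[q]`,
which has the form `act q u`, and the result is passed down to `x`. -/
lemma IsJoinIdeal.mem_fixSet_iff [IsLeftCancelMul S] (h : N.KerOre) {H : Set (QuotN N)} (hH : IsJoinIdeal H)
    (e : a * p = b * q) (hab : rightIdeal a ∩ rightIdeal b = rightIdeal (a * p)) :
    H ∈ fixSet N a b ↔ QuotN.mk N a ∈ H ∧ act a ⁻¹' H ∈ fixSet N p q := by
  let := partialOrder h
  have hl : IsLUB {QuotN.mk N a, QuotN.mk N b} (QuotN.mk N (a * p)) := isLUB_mk h hab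
  have hc : ∀ u : QuotN N, act a (act p u) = act b (act q u) := fun u => by
    rw [← act_mul, ← act_mul, e]
  constructor
  · rintro ⟨ha, hb, hx⟩
    have hap : QuotN.mk N (a * p) ∈ H := hH.mem_of_isLUB_pair h ha hb hl
    refine ⟨ha, hap, (hx (QuotN.mk N q)).2 (by rw [act_mk, ← e]; exact hap), fun u => ?_⟩
    simp only [Set.mem_preimage]
    rw [hx (act q u), hc]
  · rintro ⟨ha, hp, hq, hu⟩
    have hK := hH.preimage h ha
    have hap : QuotN.mk N (a * p) ∈ H := hp
    have hb : QuotN.mk N b ∈ H := hH.lower _ _ (e ▸ mk_le_mk_mul b q) hap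
    refine ⟨ha, hb, fun x => ⟨fun hx => ?_, fun hx => ?_⟩⟩
    · obtain ⟨z, hz, hz'⟩ := hK.join x hx _ hq
      rw [isLUB_pair_iff] at hz'
      obtain ⟨u, rfl⟩ := exists_act_of_le h hz'.2.1
      have h1 := (hu u).2 hz
      rw [Set.mem_preimage, hc] at h1
      exact hH.lower _ _ ((act_le_act h).2 hz'.1) h1
    · have hbq : act b (QuotN.mk N q) ∈ H := by rw [act_mk, ← e]; exact hap
      obtain ⟨z, hz, hz'⟩ := (hH.preimage h hb).join x hx _ hbq
      rw [isLUB_pair_iff] at hz'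
      obtain ⟨u, rfl⟩ := exists_act_of_le h hz'.2.1
      rw [Set.mem_preimage, ← hc] at hz
      exact hK.lower _ _ hz'.1 ((hu u).1 hz)

/-- A common value `a * t = b * t` is a multiple of `a * p = b * q`; cancelling `a` and `b` gives `p
* u = t = q * u`. -/
lemma B_eq_image [IsLeftCancelMul S] (e : a * p = b * q) (hab : rightIdeal a ∩ rightIdeal b = rightIdeal (a * p)) :
    B N a b = act a '' B N p q := by
  ext x
  constructor
  · rintro ⟨s, t, rfl, rfl, h'⟩
    obtain ⟨u, hu⟩ : a * t ∈ rightIdeal (a * p) := hab ▸ ⟨⟨t, rfl⟩, t, h'.symm⟩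
    have hu : a * p * u = a * t := hu
    have h1 : p * u = t := mul_left_cancel (a := a) (by rw [← mul_assoc, hu])
    have h2 : q * u = t := mul_left_cancel (a := b) (by rw [← mul_assoc, ← e, hu, h'])
    exact ⟨QuotN.mk N t, ⟨t, u, rfl, h1.symm, h2.symm⟩, rfl⟩
  · rintro ⟨_, ⟨s, u, rfl, h1, h2⟩, rfl⟩
    refine ⟨a * s, s, rfl, rfl, ?_⟩
    conv_lhs => rw [h1]
    rw [h2, ← mul_assoc, ← mul_assoc, e]

lemma IsJoinIdeal.mem_trivSet_iff [IsLeftCancelMul S] {H : Set (QuotN N)} (hH : IsJoinIdeal H)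
    (e : a * p = b * q) (hab : rightIdeal a ∩ rightIdeal b = rightIdeal (a * p)) :
    H ∈ trivSet N a b ↔ QuotN.mk N a ∈ H ∧ act a ⁻¹' H ∈ trivSet N p q := by
  rw [trivSet, B_eq_image e hab]
  constructor
  · rintro ⟨_, ⟨x, hx, rfl⟩, hxH⟩
    exact ⟨hH.lower _ _ (mk_le_act a x) hxH, x, hx, hxH⟩
  · rintro ⟨-, x, hx, hxH⟩
    exact ⟨_, ⟨x, hx, rfl⟩, hxH⟩

/-- The difference `Φ(a,b) - A(a,b)`. -/
noncomputable def defect (ν : Measure (Set (QuotN N))) (a b : S) : ℝ :=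
  ν.real (fixSet N a b) - ν.real (trivSet N a b)

variable {ν : Measure (Set (QuotN N))}

lemma IsSpectral.defect_eq_mul [IsLeftCancelMul S] [Countable S] (hν : IsSpectral ν) (h : N.KerOre) (e : a * p = b * q)
    (hab : rightIdeal a ∩ rightIdeal b = rightIdeal (a * p)) :
    defect ν a b = (N a)⁻¹ * defect ν p q := by
  have key : ∀ E E' : Set (Set (QuotN N)), MeasurableSet E' →
      (∀ H, IsJoinIdeal H → (H ∈ E ↔ QuotN.mk N a ∈ H ∧ act a ⁻¹' H ∈ E')) →
      ν.real E = (N a)⁻¹ * ν.real E' := by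
    intro E E' hE' hE
    have h1 : ν E = ν {H | QuotN.mk N a ∈ H ∧ act a ⁻¹' H ∈ E'} := by
      refine measure_congr (Filter.eventuallyEq_set.2 ?_)
      filter_upwards [hν.ae_isJoinIdeal] with H hH using hE H hH
    rw [measureReal_def, h1, hν.scaling h a hE', ENNReal.toReal_mul,
      ENNReal.toReal_ofReal (inv_nonneg.2 (N.pos a).le), measureReal_def]
  rw [defect, defect, mul_sub,
    key _ _ (measurableSet_fixSet p q) fun H hH => hH.mem_fixSet_iff h e hab,
    key _ _ (measurableSet_trivSet p q) fun H hH => hH.mem_trivSet_iff e hab]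

lemma IsSpectral.defect_eq_zero (hν : IsSpectral ν) (h : N.KerOre)
    (hab : rightIdeal a ∩ rightIdeal b = ∅) : defect ν a b = 0 := by
  have h1 : ν (fixSet N a b) = 0 := by
    refine measure_eq_zero_iff_ae_notMem.2 ?_
    filter_upwards [hν.ae_isJoinIdeal] with H hH
    rintro ⟨ha, hb, -⟩
    obtain ⟨z, -, hz⟩ := hH.join _ ha _ hb
    rw [isLUB_pair_iff] at hz
    obtain ⟨u, -, hu⟩ := exists_common_of_le h hz.1 hz.2.1
    exact (hab ▸ hu : u ∈ (∅ : Set S))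
  have h2 : trivSet N a b = ∅ := by
    refine Set.eq_empty_of_forall_notMem ?_
    rintro H ⟨_, ⟨s, t, -, rfl, h'⟩, -⟩
    exact (hab ▸ ⟨⟨t, rfl⟩, t, h'.symm⟩ : a * t ∈ (∅ : Set S))
  simp [defect, measureReal_def, h1, h2]

/-- This is what makes a failing pair in `ker N` consist of two different elements. -/
lemma IsSpectral.defect_self (hν : IsSpectral ν) (a : S) : defect ν a a = 0 := by
  rw [defect, sub_eq_zero]
  refine measureReal_congr (Filter.eventuallyEq_set.2 ?_)
  filter_upwards [hν.ae_isJoinIdeal] with H hH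
  constructor
  · rintro ⟨ha, -⟩
    exact ⟨QuotN.mk N a, ⟨a, 1, rfl, by simp, by simp⟩, ha⟩
  · rintro ⟨_, ⟨s, t, rfl, rfl, -⟩, hxH⟩
    have ha : QuotN.mk N a ∈ H := hH.lower _ _ (mk_le_mk_mul a t) hxH
    exact ⟨ha, ha, fun x => Iff.rfl⟩

lemma IsSpectral.abs_defect_le (hν : IsSpectral ν) (a b : S) : |defect ν a b| ≤ 1 := by
  have := hν.prob
  have h1 : ν.real (fixSet N a b) ≤ 1 := measureReal_le_one
  have h2 : ν.real (trivSet N a b) ≤ 1 := measureReal_le_one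
  rw [defect, abs_le]
  constructor <;> linarith [measureReal_nonneg (μ := ν) (s := fixSet N a b),
    measureReal_nonneg (μ := ν) (s := trivSet N a b)]

lemma IsSpectral.existsUnique_numbers [IsLeftCancelMul S] [Countable S] (hS : IsRightLCM S) (hν : IsSpectral ν) (h : N.KerOre)
    (hab : (rightIdeal a ∩ rightIdeal b).Nonempty) :
    (∃! x, IsTrivNumber N a b x) ∧ ∃! y, IsFixNumber N a b y := by
  obtain ⟨p, q, e, hpq⟩ := hS.exists_lcm hab
  have hm := isLUB_mk h hpq
  obtain ⟨F₀, -⟩ := exists_fixIndex h hm ∅ (by simp)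
  have : Nonempty (FixIndex N a b) := ⟨F₀⟩
  have : IsDirectedOrder (FixIndex N a b) := isDirectedOrder_fixIndex h
  exact ⟨⟨_, hν.isTrivNumber h a b, fun y hy => tendsto_nhds_unique hy (hν.isTrivNumber h a b)⟩,
    ⟨_, hν.isFixNumber hS h hm, fun y hy => tendsto_nhds_unique hy (hν.isFixNumber hS h hm)⟩⟩

lemma IsSpectral.criterionFails_iff [IsLeftCancelMul S] [Countable S] (hS : IsRightLCM S) (hν : IsSpectral ν) (h : N.KerOre)
    (hab : (rightIdeal a ∩ rightIdeal b).Nonempty) :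
    CriterionFails N a b ↔ defect ν a b ≠ 0 := by
  obtain ⟨p, q, e, hpq⟩ := hS.exists_lcm hab
  have h1 := hν.isTrivNumber h a b
  have h2 := hν.isFixNumber hS h (isLUB_mk h hpq)
  have h3 := hν.existsUnique_numbers hS h hab
  rw [defect, sub_ne_zero]
  constructor
  · rintro ⟨x, y, hx, hy, hne⟩
    rw [h3.1.unique h1 hx, h3.2.unique h2 hy]
    exact hne.symm
  · exact fun hne => ⟨_, _, h1, h2, hne.symm⟩

end Reduction

end QuotN

/-! ### The contraction argument -/

lemma Scale.OneIsolated.exists_gap {S : Type*} [Monoid S] {N : Scale S} (h : N.OneIsolated) :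
    ∃ c : ℝ, 1 < c ∧ ∀ s, s ∉ N.ker → c ≤ N s := by
  obtain ⟨U, hU, hU'⟩ := h
  obtain ⟨ε, hε, hb⟩ := Metric.mem_nhds_iff.1 hU
  refine ⟨1 + ε, by linarith, fun s hs => ?_⟩
  by_contra hlt
  refine hs (N.mem_ker.2 ?_)
  have h1 : N s ∈ U := hb (by
    rw [Metric.mem_ball, Real.dist_eq, abs_lt]
    constructor <;> linarith [N.one_le s])
  exact (hU' ▸ ⟨h1, s, rfl⟩ : N s ∈ ({1} : Set ℝ))

/-- Iterating `hstep` bounds `|f a b|` by `C * c⁻¹ ^ n` for every `n`, where `c > 1` is a lower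
bound for `N` off `ker N`. A chain that enters `ker N` stops there with value `0`; equal scales
ensure that both entries enter together. -/
lemma Scale.OneIsolated.eq_zero_of_step {S : Type*} [Monoid S] {N : Scale S} (h : N.OneIsolated)
    {f : S → S → ℝ} {C : ℝ} (hC : ∀ a b, |f a b| ≤ C)
    (hker : ∀ a ∈ N.ker, ∀ b ∈ N.ker, f a b = 0)
    (hstep : ∀ a b, N a = N b → ∃ c d, N c = N d ∧ |f a b| ≤ (N a)⁻¹ * |f c d|)
    {a b : S} (hab : N a = N b) : f a b = 0 := by
  obtain ⟨c, hc, hgap⟩ := h.exists_gap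
  have key : ∀ n : ℕ, ∀ a b, N a = N b → |f a b| ≤ C * c⁻¹ ^ n := by
    intro n
    induction n with
    | zero => intro a b _; simpa using hC a b
    | succ n ih =>
      intro a b hab
      have hC0 : 0 ≤ C := (abs_nonneg _).trans (hC a b)
      by_cases ha : a ∈ N.ker
      · rw [hker a ha b (N.mem_ker.2 (hab ▸ N.mem_ker.1 ha)), abs_zero]
        positivity
      · obtain ⟨p, q, hpq, hle⟩ := hstep a b hab
        calc |f a b| ≤ (N a)⁻¹ * |f p q| := hle
          _ ≤ c⁻¹ * (C * c⁻¹ ^ n) := by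
            have := hgap a ha
            have := ih p q hpq
            gcongr
          _ = C * c⁻¹ ^ (n + 1) := by ring
  have hlim : Tendsto (fun n : ℕ => C * c⁻¹ ^ n) atTop (𝓝 (C * 0)) :=
    (tendsto_pow_atTop_nhds_zero_of_lt_one (by positivity) (inv_lt_one_of_one_lt₀ hc)).const_mul C
  rw [mul_zero] at hlim
  exact abs_nonpos_iff.1 (ge_of_tendsto' hlim fun n => key n a b hab)

namespace QuotN

variable {S : Type*} [Monoid S] [IsLeftCancelMul S] [Countable S] {N : Scale S}

lemma IsSpectral.exists_ker_criterionFails (hS : IsRightLCM S) {ν : Measure (Set (QuotN N))}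
    (hν : IsSpectral ν) (h : N.KerOre) (hiso : N.OneIsolated) {a b : S}
    (hab : (rightIdeal a ∩ rightIdeal b).Nonempty) (hN : N a = N b)
    (hfail : CriterionFails N a b) :
    ∃ a ∈ N.ker, ∃ b ∈ N.ker, a ≠ b ∧ (rightIdeal a ∩ rightIdeal b).Nonempty ∧
      N a = N b ∧ CriterionFails N a b := by
  by_contra hcon
  push Not at hcon
  refine (hν.criterionFails_iff hS h hab).1 hfail
    (hiso.eq_zero_of_step hν.abs_defect_le (fun a ha b hb => ?_) (fun a b hN => ?_) hN)
  · by_contra hne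
    obtain ⟨c, -, d, -, e⟩ := h.common ha hb
    have hab : (rightIdeal a ∩ rightIdeal b).Nonempty := ⟨a * c, ⟨c, rfl⟩, d, e.symm⟩
    refine hcon a ha b hb ?_ hab ((N.mem_ker.1 ha).trans (N.mem_ker.1 hb).symm)
      ((hν.criterionFails_iff hS h hab).2 hne)
    rintro rfl
    exact hne (hν.defect_self a)
  · obtain he | hne := (rightIdeal a ∩ rightIdeal b).eq_empty_or_nonempty
    -- The defect is zero for disjoint ideals, so any pair of equal scale will do.
    · exact ⟨1, 1, rfl, by
        rw [hν.defect_eq_zero h he, abs_zero]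
        exact mul_nonneg (inv_nonneg.2 (N.pos a).le) (abs_nonneg _)⟩
    · obtain ⟨p, q, e, hpq⟩ := hS.exists_lcm hne
      refine ⟨p, q, ?_, ?_⟩
      · have := congrArg N.toHom e
        rw [N.map_mul, N.map_mul, ← hN] at this
        exact mul_left_cancel₀ (N.pos a).ne' this
      · rw [hν.defect_eq_mul h e hpq, abs_mul, abs_of_pos (inv_pos.2 (N.pos a))]

end QuotN

/-! ### The KMS condition for eigenvectors of the dynamics -/

section ThreeLines

open Complex

/-- The horizontal strip `0 ≤ Im z ≤ 1`. -/
def closedStrip : Set ℂ := {z | 0 ≤ z.im ∧ z.im ≤ 1}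

/-- The three lines theorem at the midpoint, after rotating the horizontal strip to the vertical one
by `z ↦ I * z`. -/
lemma norm_half_le_of_strip {g : ℂ → ℂ} (hg : Differentiable ℂ g) {M α β : ℝ}
    (hM : ∀ z ∈ closedStrip, ‖g z‖ ≤ M) (hα : ∀ t : ℝ, ‖g t‖ ≤ α)
    (hβ : ∀ t : ℝ, ‖g (t + I)‖ ≤ β) : ‖g (I / 2)‖ ≤ α ^ (1 / 2 : ℝ) * β ^ (1 / 2 : ℝ) := by
  have h := Complex.HadamardThreeLines.norm_le_interp_of_mem_verticalClosedStrip₀₁'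
    (fun z => g (I * z)) (z := 1 / 2) (a := α) (b := β) ?_ ?_ ?_ ?_ ?_
  · have h1 : ((1 / 2 : ℂ)).re = 1 / 2 := by norm_num
    rw [h1] at h
    have h2 : I / 2 = I * (1 / 2) := by ring
    have h3 : (1 / 2 : ℝ) = 1 - 1 / 2 := by norm_num
    rw [h2]
    convert h using 2
    rw [← h3]
  · norm_num [Complex.HadamardThreeLines.verticalClosedStrip]
  · exact (hg.comp (differentiable_id.const_mul I)).diffContOnCl
  · refine ⟨M, ?_⟩
    rintro _ ⟨z, hz, rfl⟩
    refine hM _ ?_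
    simpa [closedStrip, Complex.HadamardThreeLines.verticalClosedStrip] using hz
  · intro z hz
    have hz0 : z.re = 0 := hz
    have : I * z = ((-z.im : ℝ) : ℂ) := by
      apply Complex.ext <;> simp [hz0]
    simpa only [this] using hα (-z.im)
  · intro z hz
    have hz0 : z.re = 1 := hz
    have : I * z = ((-z.im : ℝ) : ℂ) + I := by
      apply Complex.ext <;> simp [hz0]
    simpa only [this] using hβ (-z.im)

/-- Decay on one boundary line is enough, as long as the bound on the other one converges. The
constants `M` inside the strip may depend on `n`. -/
lemma tendsto_half_of_strip {g : ℕ → ℂ → ℂ} (hg : ∀ n, Differentiable ℂ (g n))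
    (hM : ∀ n, ∃ M, ∀ z ∈ closedStrip, ‖g n z‖ ≤ M) {α β : ℕ → ℝ} {α₀ β₀ : ℝ}
    (hα : ∀ n, ∀ t : ℝ, ‖g n t‖ ≤ α n) (hβ : ∀ n, ∀ t : ℝ, ‖g n (t + I)‖ ≤ β n)
    (hα₀ : Tendsto α atTop (𝓝 α₀)) (hβ₀ : Tendsto β atTop (𝓝 β₀)) (h0 : α₀ = 0 ∨ β₀ = 0) :
    Tendsto (fun n => g n (I / 2)) atTop (𝓝 0) := by
  refine squeeze_zero_norm (a := fun n => α n ^ (1 / 2 : ℝ) * β n ^ (1 / 2 : ℝ)) (fun n => ?_) ?_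
  · obtain ⟨M, hM⟩ := hM n
    exact norm_half_le_of_strip (hg n) hM (hα n) (hβ n)
  · have h := (hα₀.rpow_const (p := 1 / 2) (.inr (by norm_num))).mul
      (hβ₀.rpow_const (p := 1 / 2) (.inr (by norm_num)))
    convert h using 2
    obtain rfl | rfl := h0
    · rw [Real.zero_rpow (by norm_num), zero_mul]
    · rw [Real.zero_rpow (by norm_num), mul_zero]

end ThreeLines

lemma eq_of_eq_ofReal {E : Type*} [NormedAddCommGroup E] [NormedSpace ℂ E] [CompleteSpace E]
    {F G : ℂ → E} (hF : Differentiable ℂ F) (hG : Differentiable ℂ G)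
    (h : ∀ t : ℝ, F t = G t) : F = G := by
  refine AnalyticOnNhd.eq_of_frequently_eq (z₀ := 0)
    (hF.differentiableOn.analyticOnNhd isOpen_univ) (hG.differentiableOn.analyticOnNhd isOpen_univ) ?_
  have h1 : Tendsto (fun t : ℝ => (t : ℂ)) (𝓝[≠] 0) (𝓝[≠] 0) := by
    refine tendsto_nhdsWithin_iff.2 ⟨?_, ?_⟩
    · exact (Complex.continuous_ofReal.tendsto' 0 0 (by simp)).mono_left nhdsWithin_le_nhds
    · filter_upwards [self_mem_nhdsWithin] with t ht
      simpa using ht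
  exact h1.frequently (Eventually.frequently (Eventually.of_forall fun t => h t))

/-! ### Entire orbits and the extension of the KMS condition -/

section Dynamics

variable {A : Type*} [CStarAlgebra A] {σ : ℝ → A →⋆ₐ[ℂ] A}

namespace IsEntireOrbit

variable {a : A} {F : ℂ → A}

lemma unique {G : ℂ → A} (hF : IsEntireOrbit σ a F) (hG : IsEntireOrbit σ a G) : F = G :=
  eq_of_eq_ofReal hF.1 hG.1 fun t => (hF.2 t).trans (hG.2 t).symm

lemma shift (hσ : ∀ s t x, σ s (σ t x) = σ (s + t) x) (hF : IsEntireOrbit σ a F) (t : ℝ) :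
    IsEntireOrbit σ (σ t a) fun z => F (z + t) :=
  ⟨hF.1.comp (differentiable_id.add_const _), fun s => by
    simp only [← Complex.ofReal_add, hF.2, hσ]⟩

lemma apply_add (hσ : ∀ s t x, σ s (σ t x) = σ (s + t) x) (hF : IsEntireOrbit σ a F) (t : ℝ)
    (z : ℂ) : F (z + t) = σ t (F z) := by
  have hc : Continuous (σ t) := AddMonoidHomClass.continuous_of_bound (σ t) 1 fun x => by
    rw [one_mul]; exact NonUnitalStarAlgHom.norm_apply_le (σ t) x
  let L : A →L[ℂ] A := ⟨(σ t).toAlgHom.toLinearMap, hc⟩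
  have hL : Differentiable ℂ fun z => σ t (F z) := L.differentiable.comp hF.1
  refine congrFun (eq_of_eq_ofReal (hF.1.comp (differentiable_id.add_const _)) hL fun s => ?_) z
  change F (s + t) = σ t (F s)
  rw [← Complex.ofReal_add, hF.2, hF.2, hσ, add_comm]

/-- A real translation of the argument acts through the contraction `σ t`, so a bound on the compact
segment from `0` to `I` suffices. -/
lemma bounded (hσ : ∀ s t x, σ s (σ t x) = σ (s + t) x) (hF : IsEntireOrbit σ a F) :
    ∃ M, ∀ z ∈ closedStrip, ‖F z‖ ≤ M := by
  have hc : ContinuousOn (fun y : ℝ => F (y * Complex.I)) (Set.Icc 0 1) :=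
    (hF.1.continuous.comp (by fun_prop)).continuousOn
  obtain ⟨M, hM⟩ := isCompact_Icc.exists_bound_of_continuousOn hc
  refine ⟨M, fun z hz => ?_⟩
  have : z = z.im * Complex.I + z.re := by
    rw [add_comm]; exact (Complex.re_add_im z).symm
  rw [this, hF.apply_add hσ]
  exact (NonUnitalStarAlgHom.norm_apply_le (σ z.re) _).trans (hM z.im hz)

end IsEntireOrbit

open Complex in
/-- The KMS condition for an eigenvector of the dynamics. -/
lemma IsKMSState.apply_eigenvector (hσ : ∀ s t x, σ s (σ t x) = σ (s + t) x) {φ : A →L[ℂ] ℂ}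
    (hφ : IsKMSState σ 1 φ) {r : ℝ} (hr : 1 ≤ r) {c : A}
    (hc : ∀ t : ℝ, σ t c = (r : ℂ) ^ ((t : ℂ) * I) • c) (b : A) :
    φ (c * b) = (r : ℂ)⁻¹ * φ (b * c) := by
  obtain ⟨-, D, hD, hDσ, hK⟩ := hφ
  obtain ⟨a, haD, ha⟩ := mem_closure_iff_seq_limit.1 (hD c)
  obtain ⟨d, hdD, hd⟩ := mem_closure_iff_seq_limit.1 (hD b)
  choose F hF hFφ using fun n => hK (a n) (haD n)
  have hr0 : (r : ℂ) ≠ 0 := ofReal_ne_zero.2 (by linarith)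
  -- The scalar `e` continues the eigenvalue of `c` analytically. It is unimodular on the real line
  -- and picks up the factor `r⁻¹` under `z ↦ z + I`.
  let e : ℂ → ℂ := fun z => (r : ℂ) ^ (z * I)
  have he : Differentiable ℂ e := fun z =>
    ((differentiableAt_id.mul_const I).const_cpow (.inl hr0))
  have he_norm : ∀ z, ‖e z‖ = r ^ (-z.im) := fun z => by
    rw [norm_cpow_eq_rpow_re_of_pos (by linarith)]; simp
  have he_real : ∀ t : ℝ, ‖e t‖ = 1 := fun t => by simp [he_norm]
  have he_le : ∀ z ∈ closedStrip, ‖e z‖ ≤ 1 := fun z hz => by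
    rw [he_norm]; exact Real.rpow_le_one_of_one_le_of_nonpos hr (by linarith [hz.1])
  have he_top : ∀ z, e (z + I) = e z * (r : ℂ)⁻¹ := fun z => by
    simp only [e]
    rw [add_mul, I_mul_I, cpow_add _ _ hr0, cpow_neg_one]
  have hσn : ∀ t x, ‖σ t x‖ ≤ ‖x‖ := fun t x => NonUnitalStarAlgHom.norm_apply_le (σ t) x
  let f : ℕ → ℂ → ℂ := fun n z => φ (d n * F n z)
  have hf : ∀ n, Differentiable ℂ (f n) := fun n =>
    φ.differentiable.comp ((hF n).1.const_mul (d n))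
  have hfM : ∀ n, ∃ M, ∀ z ∈ closedStrip, ‖f n z‖ ≤ M := by
    intro n
    obtain ⟨M, hM⟩ := (hF n).bounded hσ
    refine ⟨‖φ‖ * (‖d n‖ * M), fun z hz => (φ.le_opNorm _).trans ?_⟩
    gcongr
    exact (norm_mul_le _ _).trans (by gcongr; exact hM z hz)
  have hbot : ∀ n, ∀ t : ℝ, ‖f n t - e t * φ (b * c)‖ ≤
      ‖φ‖ * (‖d n‖ * ‖a n - c‖ + ‖d n - b‖ * ‖c‖) := by
    intro n t
    have h1 : f n t - e t * φ (b * c) =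
        φ (d n * σ t (a n - c) + (d n - b) * σ t c) := by
      have h2 : e t * φ (b * c) = φ (b * σ t c) := by
        rw [hc, mul_smul_comm, map_smul, smul_eq_mul]
      rw [h2]
      simp only [f]
      rw [(hF n).2, ← map_sub, map_sub (σ t)]
      congr 1
      noncomm_ring
    rw [h1]
    refine (φ.le_opNorm _).trans ?_
    gcongr
    refine (norm_add_le _ _).trans ?_
    gcongr
    · exact (norm_mul_le _ _).trans (by gcongr; exact hσn _ _)
    · exact (norm_mul_le _ _).trans (by gcongr; exact hσn _ _)
  have htop : ∀ n, ∀ t : ℝ, ‖f n (t + I) - e t * φ (c * b)‖ ≤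
      ‖φ‖ * (‖a n - c‖ * ‖d n‖ + ‖c‖ * ‖d n - b‖) := by
    intro n t
    -- The KMS condition is applied to `σ t (a n)`, which lies in `D` by invariance and whose entire
    -- orbit is a translate of `F n`.
    have h0 : f n (t + I) = φ (σ t (a n) * d n) := by
      obtain ⟨G, hG, hGφ⟩ := hK (σ t (a n)) (hDσ t _ (haD n))
      rw [hGφ (d n) (hdD n), hG.unique ((hF n).shift hσ t)]
      simp only [f]
      rw [ofReal_one, one_mul, add_comm]
    have h1 : f n (t + I) - e t * φ (c * b) =
        φ (σ t (a n - c) * d n + σ t c * (d n - b)) := by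
      have h2 : e t * φ (c * b) = φ (σ t c * b) := by
        rw [hc, smul_mul_assoc, map_smul, smul_eq_mul]
      rw [h2, h0, ← map_sub, map_sub (σ t)]
      congr 1
      noncomm_ring
    rw [h1]
    refine (φ.le_opNorm _).trans ?_
    gcongr
    refine (norm_add_le _ _).trans ?_
    gcongr
    · exact (norm_mul_le _ _).trans (by gcongr; exact hσn _ _)
    · exact (norm_mul_le _ _).trans (by gcongr; exact hσn _ _)
  have hα : Tendsto (fun n => ‖φ‖ * (‖d n‖ * ‖a n - c‖ + ‖d n - b‖ * ‖c‖)) atTop (𝓝 0) := by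
    have h1 := (tendsto_iff_norm_sub_tendsto_zero.1 ha)
    have h2 := (tendsto_iff_norm_sub_tendsto_zero.1 hd)
    have := ((hd.norm.mul h1).add (h2.mul_const ‖c‖)).const_mul ‖φ‖
    simpa using this
  have hβ : Tendsto (fun n => ‖φ‖ * (‖a n - c‖ * ‖d n‖ + ‖c‖ * ‖d n - b‖)) atTop (𝓝 0) := by
    have h1 := (tendsto_iff_norm_sub_tendsto_zero.1 ha)
    have h2 := (tendsto_iff_norm_sub_tendsto_zero.1 hd)
    have := ((h1.mul hd.norm).add (h2.const_mul ‖c‖)).const_mul ‖φ‖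
    simpa using this
  -- On the lower line `f n` approaches `e * φ (b * c)`, on the upper line `e(t) * φ (c * b)`. Each
  -- admissible `w` makes `f n - e * w` small on one line and bounded on the other, so it tends to
  -- zero at `I / 2`. Comparing the two choices of `w` gives the identity.
  have hgen : ∀ w : ℂ, (w = φ (b * c) ∨ (r : ℂ)⁻¹ * w = φ (c * b)) →
      Tendsto (fun n => f n (I / 2) - e (I / 2) * w) atTop (𝓝 0) := by
    intro w hw
    refine tendsto_half_of_strip (g := fun n z => f n z - e z * w)
      (fun n => (hf n).sub (he.mul_const w)) (fun n => ?_)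
      (α := fun n => ‖φ‖ * (‖d n‖ * ‖a n - c‖ + ‖d n - b‖ * ‖c‖) + ‖φ (b * c) - w‖)
      (β := fun n => ‖φ‖ * (‖a n - c‖ * ‖d n‖ + ‖c‖ * ‖d n - b‖) + ‖φ (c * b) - (r : ℂ)⁻¹ * w‖)
      (fun n t => ?_) (fun n t => ?_) (hα.add_const _) (hβ.add_const _) ?_
    · obtain ⟨M, hM⟩ := hfM n
      refine ⟨M + 1 * ‖w‖, fun z hz => (norm_sub_le _ _).trans ?_⟩
      rw [norm_mul]
      gcongr
      · exact hM z hz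
      · exact he_le z hz
    · have : f n t - e t * w = (f n t - e t * φ (b * c)) + e t * (φ (b * c) - w) := by ring
      rw [this]
      refine (norm_add_le _ _).trans (add_le_add (hbot n t) ?_)
      rw [norm_mul, he_real, one_mul]
    · have : f n (t + I) - e (t + I) * w =
          (f n (t + I) - e t * φ (c * b)) + e t * (φ (c * b) - (r : ℂ)⁻¹ * w) := by
        rw [he_top]; ring
      rw [this]
      refine (norm_add_le _ _).trans (add_le_add (htop n t) ?_)
      rw [norm_mul, he_real, one_mul]
    · obtain rfl | hw := hw
      · left; simp
      · right; simp [hw]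
  have h1 := hgen (φ (b * c)) (.inl rfl)
  have h2 := hgen (r * φ (c * b)) (.inr (inv_mul_cancel_left₀ hr0 _))
  have h3 := h1.sub h2
  rw [sub_zero] at h3
  have h4 : e (I / 2) * (r * φ (c * b) - φ (b * c)) = 0 := by
    refine tendsto_nhds_unique (tendsto_const_nhds.congr fun n => ?_) h3
    ring
  have h5 : e (I / 2) ≠ 0 := by
    simp only [e]
    rw [cpow_ne_zero_iff]
    exact .inl hr0
  have h6 := sub_eq_zero.1 ((mul_eq_zero.1 h4).resolve_left h5)
  rw [← h6, inv_mul_cancel_left₀ hr0]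

end Dynamics

lemma prodDyn_comp {S : Type*} [Monoid S] (N : Scale S) (s t : ℝ) (f : RepProd S) :
    prodDyn N s (prodDyn N t f) = prodDyn N (s + t) f := by
  apply lp.ext
  funext V
  -- The two twisted representations have the same algebra, so it suffices to compare their families
  -- of isometries.
  have key : ∀ (w w' : S → V.Alg) (hw : IsRep w) (hw' : IsRep w'), w = w' →
      (f ⟨V.Alg, w, hw⟩ : V.Alg) = f ⟨V.Alg, w', hw'⟩ := by
    rintro w w' hw hw' rfl; rfl
  refine key _ _ ((V.isRep.twist N s).twist N t) (V.isRep.twist N (s + t)) ?_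
  funext x
  rw [smul_smul]
  congr 1
  rw [Scale.phase, Scale.phase, Scale.phase, ← Complex.cpow_add]
  · congr 1; push_cast; ring
  · exact Complex.ofReal_ne_zero.2 (N.pos x).ne'

lemma dyn_comp {S : Type*} [Monoid S] (N : Scale S) (s t : ℝ) (x : CS S) :
    dyn N s (dyn N t x) = dyn N (s + t) x :=
  Subtype.ext (prodDyn_comp N s t x)

lemma IsKMSState.gen_mul {S : Type*} [Monoid S] {N : Scale S} {φ : CS S →L[ℂ] ℂ}
    (hφ : IsKMSState (dyn N) 1 φ) (s : S) (b : CS S) :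
    φ (CS.gen s * b) = (N s : ℂ)⁻¹ * φ (b * CS.gen s) :=
  hφ.apply_eigenvector (dyn_comp N) (N.one_le s) (fun t => dyn_gen N t s) b

/-! ### The measure defined by a state on commuting projections -/

open WeakDual in
/-- The measure on the spectrum given by a state on a commutative C*-algebra. -/
lemma exists_measure_of_state.{u} {B : Type u} [CommCStarAlgebra B] {φ : B →L[ℂ] ℂ} (hφ : IsState φ) :
    ∃ (X : Type u) (_ : MeasurableSpace X) (μ : Measure X) (W : B → Set X),
      IsProbabilityMeasure μ ∧ (∀ e, IsStarProjection e → MeasurableSet (W e) ∧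
        μ (W e) = ENNReal.ofReal (φ e).re) ∧
      (∀ e f, IsStarProjection e → IsStarProjection f → W e ∩ W f = W (e * f)) ∧ W 0 = ∅ := by
  let X := characterSpace ℂ B
  let : MeasurableSpace X := borel X
  have : BorelSpace X := ⟨rfl⟩
  let G := gelfandStarTransform B
  let toC : C(X, ℝ) → C(X, ℂ) := fun f => ⟨fun x => (f x : ℂ), by fun_prop⟩
  let Λ₀ : CompactlySupportedContinuousMap X ℝ →ₗ[ℝ] ℝ :=
    { toFun := fun f => (φ (G.symm (toC f.toContinuousMap))).re
      map_add' := fun f g => by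
        have : toC (f + g).toContinuousMap = toC f.toContinuousMap + toC g.toContinuousMap := by
          ext x; simp [toC]
        rw [this, map_add, map_add, Complex.add_re]
      map_smul' := fun r f => by
        have : toC (r • f).toContinuousMap = (r : ℂ) • toC f.toContinuousMap := by
          ext x; simp [toC]
        rw [this, map_smul, map_smul, smul_eq_mul, Complex.re_ofReal_mul]
        rfl }
  have hΛ : ∀ f, 0 ≤ f → 0 ≤ Λ₀ f := by
    intro f hf
    -- A nonnegative function is `star g * g` for its square root `g`, so positivity of `φ` applies.
    let g : C(X, ℝ) := ⟨fun x => Real.sqrt (f x), by fun_prop⟩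
    have hfg : toC f.toContinuousMap = star (toC g) * toC g := by
      ext x
      have : (f x : ℝ) = Real.sqrt (f x) * Real.sqrt (f x) := (Real.mul_self_sqrt (hf x)).symm
      simp only [toC, g, ContinuousMap.coe_mk, ContinuousMap.mul_apply, ContinuousMap.star_apply,
        Complex.star_def, Complex.conj_ofReal]
      rw [← Complex.ofReal_mul, ← this]
      rfl
    change 0 ≤ (φ (G.symm (toC f.toContinuousMap))).re
    rw [hfg, map_mul, map_star]
    exact (Complex.le_def.1 (hφ.2 _)).1
  let Λ := PositiveLinearMap.mk₀ Λ₀ hΛ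
  let μ := RealRMK.rieszMeasure Λ
  have hint : ∀ (f : C(X, ℝ)) (b : B), (∀ χ : X, χ b = f χ) → ∫ χ, f χ ∂μ = (φ b).re := by
    intro f b hb
    have h1 := RealRMK.integral_rieszMeasure Λ (CompactlySupportedContinuousMap.continuousMapEquiv f)
    have h2 : G.symm (toC f) = b := by
      rw [StarAlgEquiv.symm_apply_eq]
      ext χ
      exact (hb χ).symm
    rw [← h2]
    exact h1
  have hval : ∀ e, IsStarProjection e → ∀ χ : X, χ e = 0 ∨ χ e = 1 := by
    intro e he χ
    have h1 : χ e * χ e = χ e := by rw [← map_mul, he.isIdempotentElem.eq]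
    exact IsIdempotentElem.iff_eq_zero_or_one.1 h1
  have hone : μ Set.univ = 1 := by
    have h1 := hint 1 1 (fun χ => by simp)
    rw [hφ.1] at h1
    simpa [measureReal_def, ENNReal.toReal_eq_one_iff] using h1
  have hprob : IsProbabilityMeasure μ := ⟨hone⟩
  refine ⟨↥X, inferInstance, μ, fun e => {χ | χ e = 1}, hprob, fun e he => ?_, fun e f he hf => ?_, ?_⟩
  · have hc : Continuous fun χ : X => χ e := (gelfandTransform ℂ B e).continuous
    have hm : MeasurableSet {χ : X | χ e = 1} := (isClosed_singleton.preimage hc).measurableSet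
    refine ⟨hm, ?_⟩
    have h1 := hint ⟨fun χ => (χ e).re, Complex.continuous_re.comp hc⟩ e (fun χ => by
      obtain h | h := hval e he χ <;> simp [h])
    have h2 : ∀ χ : X, (χ e).re = {χ : X | χ e = 1}.indicator (fun _ => (1 : ℝ)) χ := by
      intro χ
      obtain h | h := hval e he χ <;> simp [h]
    rw [← h1]
    simp only [ContinuousMap.coe_mk, h2]
    rw [integral_indicator_const _ hm, smul_eq_mul, mul_one, ofReal_measureReal]
  · ext χ
    simp only [Set.mem_inter_iff, Set.mem_ofPred_eq, map_mul]
    obtain h | h := hval e he χ <;> simp [h]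
  · ext χ; simp

namespace IsRep

variable {S : Type*} [Monoid S] {A : Type*} [CStarAlgebra A] {v : S → A}

lemma isStarProjection (h : IsRep v) (s : S) : IsStarProjection (v s * star (v s)) where
  isIdempotentElem := by
    rw [IsIdempotentElem, mul_assoc, ← mul_assoc (star (v s)), h.isometry, one_mul]
  isSelfAdjoint := IsSelfAdjoint.mul_star_self _

lemma projection_comm (hS : IsRightLCM S) (h : IsRep v) (s t : S) :
    v s * star (v s) * (v t * star (v t)) = v t * star (v t) * (v s * star (v s)) := by
  obtain he | ⟨r, hr⟩ := hS s t
  · rw [h.range_orth s t he, h.range_orth t s (by rw [Set.inter_comm, he])]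
  · rw [h.range_mul s t r hr, h.range_mul t s r (by rw [Set.inter_comm, hr])]

end IsRep

/-- The projections `v_s v_s^*` commute, so `φ` restricts to a state on the commutative C*-algebra
they generate, and this is a measure on its spectrum. The KMS condition gives `φ (v_s v_s^*) = (N
s)⁻¹ * φ (v_s^* v_s) = (N s)⁻¹`. -/
lemma IsKMSState.exists_isModel.{u} {S : Type u} [Monoid S] (hS : IsRightLCM S) {N : Scale S}
    {φ : CS S →L[ℂ] ℂ} (hφ : IsKMSState (dyn N) 1 φ) :
    ∃ (X : Type (u + 1)) (_ : MeasurableSpace X) (μ : Measure X) (W : S → Set X), IsModel N μ W := by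
  have hv := CS.gen_isRep S
  let p : S → CS S := fun s => CS.gen s * star (CS.gen s)
  let D : StarSubalgebra ℂ (CS S) := StarAlgebra.adjoin ℂ (Set.range p)
  let B : StarSubalgebra ℂ (CS S) := D.topologicalClosure
  have hD : IsMulCommutative D := StarAlgebra.isMulCommutative_adjoin ℂ
    (by rintro _ ⟨s, rfl⟩ _ ⟨t, rfl⟩; exact hv.projection_comm hS s t)
    (by
      rintro _ ⟨s, rfl⟩ _ ⟨t, rfl⟩
      rw [(hv.isStarProjection t).isSelfAdjoint.star_eq]
      exact hv.projection_comm hS s t)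
  have hcomm : ∀ x y : B, x * y = y * x :=
    (D.commRingTopologicalClosure fun x y => hD.is_comm.comm x y).mul_comm
  have : CompleteSpace B := (StarSubalgebra.isClosed_topologicalClosure D).completeSpace_coe
  let : CommCStarAlgebra B := { ({} : CStarAlgebra B) with mul_comm := hcomm }
  have hpB : ∀ s, p s ∈ B := fun s => D.le_topologicalClosure
    (StarAlgebra.subset_adjoin ℂ _ (Set.mem_range_self s))
  let q : S → B := fun s => ⟨p s, hpB s⟩
  have hq : ∀ s, IsStarProjection (q s) := fun s =>
    ⟨Subtype.ext (hv.isStarProjection s).isIdempotentElem,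
      Subtype.ext (hv.isStarProjection s).isSelfAdjoint⟩
  let ψ : B →L[ℂ] ℂ := φ.comp ⟨B.toSubalgebra.toSubmodule.subtype, continuous_subtype_val⟩
  have hψ : IsState ψ := ⟨hφ.1.1, fun a => hφ.1.2 a⟩
  obtain ⟨X, _, μ, W, hμ, hW, hWi, hW0⟩ := exists_measure_of_state hψ
  refine ⟨X, inferInstance, μ, fun s => W (q s), hμ, fun s => (hW _ (hq s)).1, fun s => ?_,
    fun s t r h => ?_, fun s t h => ?_⟩
  · rw [(hW _ (hq s)).2]
    congr 1
    have h1 : ψ (q s) = ((N s)⁻¹ : ℝ) := by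
      change φ (CS.gen s * star (CS.gen s)) = _
      rw [hφ.gen_mul, hv.isometry, hφ.1.1, mul_one, Complex.ofReal_inv]
    rw [h1, Complex.ofReal_re]
  · rw [hWi _ _ (hq s) (hq t)]
    exact congrArg W (Subtype.ext (hv.range_mul s t r h))
  · rw [hWi _ _ (hq s) (hq t), ← hW0]
    exact congrArg W (Subtype.ext (hv.range_orth s t h))

lemma isModel_charSpace {S : Type*} [Monoid S] {N : Scale S} {μ : Measure (CharSpace S)}
    [hμ : IsProbabilityMeasure μ] (h : ∀ s, μ (Z s) = ENNReal.ofReal (N s)⁻¹) : IsModel N μ Z where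
  prob := hμ
  meas s := by
    have hc : Continuous fun χ : CharSpace S => χ.1 (Idem.of s) :=
      (continuous_apply (Idem.of s)).comp continuous_subtype_val
    exact ((isClosed_discrete {true}).preimage hc).measurableSet
  apply := h
  inter s t r hr := by
    ext χ
    have := χ.2.2.2 (Idem.of s) (Idem.of t) (Idem.of r) hr.symm
    simp only [Z, Set.mem_inter_iff, Set.mem_ofPred_eq, this, Bool.and_eq_true]
  disj s t he := by
    ext χ
    have := χ.2.2.2 (Idem.of s) (Idem.of t) (Idem.zero S) he.symm
    rw [χ.2.2.1] at this
    simp only [Z, Set.mem_inter_iff, Set.mem_ofPred_eq, Set.mem_empty_iff_false, iff_false,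
      ← Bool.and_eq_true, ← this]
    exact Bool.false_ne_true

/-! ### The canonical homomorphism `C*(ker N) → C*(S)` -/

section Kernel

variable {S : Type*} [Monoid S] {N : Scale S}

/-- Two elements of `ker N` have a common multiple in `ker N`. Their least common multiple in `S`
divides it, so it lies in `ker N` too and must generate the same ideal as `r`. -/
lemma rightIdeal_inter_of_ker (hS : IsRightLCM S) (h : N.KerOre) {s t r : N.ker}
    (hr : rightIdeal s ∩ rightIdeal t = rightIdeal r) :
    rightIdeal (s : S) ∩ rightIdeal (t : S) = rightIdeal (r : S) := by
  have hrm : r ∈ rightIdeal s ∩ rightIdeal t := hr ▸ self_mem_rightIdeal r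
  obtain ⟨⟨x, hx⟩, y, hy⟩ := hrm
  obtain ⟨c, hc, d, hd, e⟩ := h.common s.2 t.2
  obtain ⟨p, q, e', hpq⟩ := hS.exists_lcm (s := (s : S)) (t := t) ⟨s * c, ⟨c, rfl⟩, d, e.symm⟩
  have h1 : (s : S) * c ∈ rightIdeal ((s : S) * p) := hpq ▸ ⟨⟨c, rfl⟩, d, e.symm⟩
  obtain ⟨w, hw⟩ := h1
  have hsp : (s : S) * p ∈ N.ker :=
    Scale.mem_ker_left (b := w) (by simpa only [hw] using mul_mem s.2 hc)
  have hp : p ∈ N.ker := Scale.mem_ker_right hsp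
  have hq : q ∈ N.ker := Scale.mem_ker_right (e' ▸ hsp)
  have h2 : s * ⟨p, hp⟩ ∈ rightIdeal r := by
    rw [← hr]
    exact ⟨⟨_, rfl⟩, ⟨q, hq⟩, Subtype.ext e'.symm⟩
  obtain ⟨z, hz⟩ := h2
  have hz' : (r : S) * z = s * p := congrArg Subtype.val hz
  rw [hpq]
  refine (rightIdeal_subset ⟨(z : S), hz'⟩).antisymm (rightIdeal_subset ?_)
  rw [← hpq]
  exact ⟨⟨x, congrArg Subtype.val hx⟩, y, congrArg Subtype.val hy⟩

lemma IsRep.restrict_ker (hS : IsRightLCM S) (h : N.KerOre) {A : Type*} [CStarAlgebra A]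
    {v : S → A} (hv : IsRep v) : IsRep fun t : N.ker => v t where
  map_one := hv.map_one
  map_mul s t := hv.map_mul s t
  isometry s := hv.isometry s
  range_mul s t r hr := hv.range_mul s t r (rightIdeal_inter_of_ker hS h hr)
  range_orth s t he := by
    -- The orthogonality relation is vacuous: ideals of `ker N` always meet.
    obtain ⟨c, hc, d, hd, e⟩ := h.common s.2 t.2
    have : s * ⟨c, hc⟩ ∈ rightIdeal s ∩ rightIdeal t :=
      ⟨⟨_, rfl⟩, ⟨d, hd⟩, Subtype.ext e.symm⟩
    rw [he] at this
    exact this.elim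

/-- The restriction of a representation to `ker N`. -/
def Rep.restrictKer (hS : IsRightLCM S)
    (h : N.KerOre) (V : Rep S) : Rep N.ker :=
  ⟨V.Alg, fun t => V.v t, V.isRep.restrict_ker hS h⟩

/-- The homomorphism of products of representations that is dual to the restriction. -/
noncomputable def prodRestrict (hS : IsRightLCM S) (h : N.KerOre) :
    RepProd N.ker →⋆ₐ[ℂ] RepProd S where
  toFun f := ⟨fun V => f (V.restrictKer hS h), memℓp_infty ⟨‖f‖, by
    rintro _ ⟨V, rfl⟩
    exact lp.norm_apply_le_norm ENNReal.top_ne_zero f (V.restrictKer hS h)⟩⟩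
  map_one' := rfl
  map_mul' _ _ := rfl
  map_zero' := rfl
  map_add' _ _ := rfl
  commutes' _ := rfl
  map_star' _ := rfl

/-- `CS S` lives one universe above `S`, so `CS.exists_lift` does not apply to it as a target. The
homomorphism is instead defined coordinatewise, by restricting each representation of `S` to `ker
N`. -/
lemma exists_hom_ker (hS : IsRightLCM S) (h : N.KerOre) :
    ∃ ι : CS N.ker →⋆ₐ[ℂ] CS S, ∀ t : N.ker, ι (CS.gen t) = CS.gen (t : S) := by
  have hcont : Continuous (prodRestrict hS h) := by
    refine AddMonoidHomClass.continuous_of_bound (prodRestrict hS h) 1 fun f => ?_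
    rw [one_mul]
    refine lp.norm_le_of_forall_le (norm_nonneg f) fun V => ?_
    exact lp.norm_apply_le_norm ENNReal.top_ne_zero f (V.restrictKer hS h)
  have hle : StarAlgebra.adjoin ℂ (Set.range (prodGen (S := N.ker))) ≤
      (cstarSub S).comap (prodRestrict hS h) := by
    refine StarAlgebra.adjoin_le ?_
    rintro _ ⟨s, rfl⟩
    exact (CS.gen (s : S)).2
  have hcl : IsClosed ((cstarSub S).comap (prodRestrict hS h) : Set (RepProd N.ker)) :=
    (StarSubalgebra.isClosed_topologicalClosure _).preimage hcont
  exact ⟨((prodRestrict hS h).comp (cstarSub N.ker).subtype).codRestrict (cstarSub S)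
    fun f => StarSubalgebra.topologicalClosure_minimal hle hcl f.2, fun _ => rfl⟩

end Kernel

/-! ### States that agree on `C*(ker N)` -/

/-- Polarization: `φ` is real on `star (a + c) * (a + c)`, and the scalars `c = 1` and `c = I` yield
the real and imaginary parts. -/
lemma IsState.map_star {A : Type*} [CStarAlgebra A] {φ : A →L[ℂ] ℂ} (hφ : IsState φ) (a : A) :
    φ (star a) = star (φ a) := by
  have key : ∀ c : ℂ, (c * φ (star a) + star c * φ a).im = 0 := by
    intro c
    have h1 := (Complex.le_def.1 (hφ.2 (a + algebraMap ℂ A c))).2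
    have h2 := (Complex.le_def.1 (hφ.2 a)).2
    have h3 : star (a + algebraMap ℂ A c) * (a + algebraMap ℂ A c) =
        star a * a + (c • star a + star c • a) + (star c * c) • (1 : A) := by
      simp only [Algebra.algebraMap_eq_smul_one, star_add, star_smul, star_one, add_mul, mul_add,
        smul_mul_assoc, mul_smul_comm, one_mul, mul_one, smul_add, mul_smul]
      rw [smul_comm c]
      abel
    have h4 : (star c * c).im = 0 := by
      simp [mul_comm]
    rw [h3, map_add, map_add, map_add, map_smul, map_smul, map_smul, hφ.1, smul_eq_mul,
      smul_eq_mul, smul_eq_mul, mul_one, Complex.add_im, Complex.add_im, ← h2, h4] at h1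
    simpa using h1.symm
  have h1 := key 1
  have h2 := key Complex.I
  simp at h1 h2
  apply Complex.ext
  · simp; linarith
  · simp; linarith

/-! ### The algebra of monomials `v_s v_t^*` -/

namespace IsRep

variable {S : Type*} [Monoid S] {A : Type*} [CStarAlgebra A] {v : S → A}

lemma star_mul_eq_zero (h : IsRep v) {s t : S} (he : rightIdeal s ∩ rightIdeal t = ∅) :
    star (v t) * v s = 0 := by
  have h1 := h.range_orth t s (by rw [Set.inter_comm, he])
  calc star (v t) * v s = star (v t) * v t * (star (v t) * v s) * (star (v s) * v s) := by
        rw [h.isometry, h.isometry, one_mul, mul_one]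
    _ = star (v t) * (v t * star (v t) * (v s * star (v s))) * v s := by
        simp only [mul_assoc]
    _ = 0 := by rw [h1, mul_zero, zero_mul]

/-- Inserting `v_t^* v_t = 1` on the left and `v_s^* v_s = 1` on the right produces the product of
the two range projections, which is the range projection of the least common multiple. -/
lemma star_mul_eq (h : IsRep v) {s t p q : S} (e : s * p = t * q)
    (he : rightIdeal s ∩ rightIdeal t = rightIdeal (s * p)) :
    star (v t) * v s = v q * star (v p) := by
  have h1 := h.range_mul t s (s * p) (by rw [Set.inter_comm, he])
  calc star (v t) * v s = star (v t) * v t * (star (v t) * v s) * (star (v s) * v s) := by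
        rw [h.isometry, h.isometry, one_mul, mul_one]
    _ = star (v t) * (v t * star (v t) * (v s * star (v s))) * v s := by
        simp only [mul_assoc]
    _ = star (v t) * (v (t * q) * star (v (s * p))) * v s := by rw [h1, e]
    _ = star (v t) * v t * (v q * star (v p)) * (star (v s) * v s) := by
        rw [h.map_mul, h.map_mul, star_mul]; simp only [mul_assoc]
    _ = v q * star (v p) := by rw [h.isometry, h.isometry, one_mul, mul_one]

/-- The linear span of the elements `v_s v_t^*`. -/
noncomputable def monomialSpan {S : Type*} (v : S → A) : Submodule ℂ A :=
  Submodule.span ℂ (Set.range fun x : S × S => v x.1 * star (v x.2))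

lemma monomial_mem {S : Type*} (v : S → A) (s t : S) : v s * star (v t) ∈ monomialSpan v :=
  Submodule.subset_span ⟨(s, t), rfl⟩

lemma star_mem_monomialSpan {S : Type*} {v : S → A} {x : A} (hx : x ∈ monomialSpan v) : star x ∈ monomialSpan v := by
  induction hx using Submodule.span_induction with
  | mem x hx =>
    obtain ⟨⟨s, t⟩, rfl⟩ := hx
    simpa using monomial_mem v t s
  | zero => simp
  | add x y _ _ hx hy => rw [star_add]; exact add_mem hx hy
  | smul c x _ hx => rw [star_smul]; exact Submodule.smul_mem _ _ hx

lemma mul_mem_monomialSpan (hS : IsRightLCM S) (h : IsRep v) {x y : A} (hx : x ∈ monomialSpan v)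
    (hy : y ∈ monomialSpan v) : x * y ∈ monomialSpan v := by
  induction hx, hy using Submodule.span_induction₂ with
  | mem_mem x y hx hy =>
    obtain ⟨⟨s, t⟩, rfl⟩ := hx
    obtain ⟨⟨a, b⟩, rfl⟩ := hy
    have h1 : v s * star (v t) * (v a * star (v b)) = v s * (star (v t) * v a) * star (v b) := by
      simp only [mul_assoc]
    simp only [h1]
    obtain he | hne := (rightIdeal a ∩ rightIdeal t).eq_empty_or_nonempty
    · rw [h.star_mul_eq_zero he, mul_zero, zero_mul]
      exact zero_mem _
    · obtain ⟨p, q, e, hpq⟩ := hS.exists_lcm hne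
      have h2 : v s * (v q * star (v p)) * star (v b) = v (s * q) * star (v (b * p)) := by
        rw [h.map_mul, h.map_mul, star_mul]; simp only [mul_assoc]
      rw [h.star_mul_eq e hpq, h2]
      exact monomial_mem v _ _
  | zero_left => simp
  | zero_right => simp
  | add_left x y z _ _ _ hx hy => rw [add_mul]; exact add_mem hx hy
  | add_right x y z _ _ _ hx hy => rw [mul_add]; exact add_mem hx hy
  | smul_left c x y _ _ hx => rw [smul_mul_assoc]; exact Submodule.smul_mem _ _ hx
  | smul_right c x y _ _ hx => rw [mul_smul_comm]; exact Submodule.smul_mem _ _ hx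

end IsRep

lemma CS.dense_monomialSpan {S : Type*} [Monoid S] (hS : IsRightLCM S) :
    Dense (IsRep.monomialSpan (CS.gen (S := S)) : Set (CS S)) := by
  have hv := CS.gen_isRep S
  have h1 : (1 : CS S) ∈ IsRep.monomialSpan (CS.gen (S := S)) := by
    have := IsRep.monomial_mem (CS.gen (S := S)) 1 1
    rwa [hv.map_one, star_one, mul_one] at this
  have key : ∀ u ∈ StarAlgebra.adjoin ℂ (Set.range (prodGen (S := S))),
      ∃ y ∈ IsRep.monomialSpan (CS.gen (S := S)), (y : RepProd S) = u := by
    intro u hu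
    induction hu using StarAlgebra.adjoin_induction with
    | mem u hu =>
      obtain ⟨s, rfl⟩ := hu
      refine ⟨CS.gen s, ?_, rfl⟩
      have := IsRep.monomial_mem (CS.gen (S := S)) s 1
      rwa [hv.map_one, star_one, mul_one] at this
    | algebraMap c =>
      exact ⟨algebraMap ℂ (CS S) c, by
        rw [Algebra.algebraMap_eq_smul_one]; exact Submodule.smul_mem _ _ h1, rfl⟩
    | add x y _ _ hx hy =>
      obtain ⟨x, hx, rfl⟩ := hx
      obtain ⟨y, hy, rfl⟩ := hy
      exact ⟨x + y, add_mem hx hy, rfl⟩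
    | mul x y _ _ hx hy =>
      obtain ⟨x, hx, rfl⟩ := hx
      obtain ⟨y, hy, rfl⟩ := hy
      exact ⟨x * y, hv.mul_mem_monomialSpan hS hx hy, rfl⟩
    | star x _ hx =>
      obtain ⟨x, hx, rfl⟩ := hx
      exact ⟨star x, IsRep.star_mem_monomialSpan hx, rfl⟩
  intro x
  obtain ⟨u, hu, hux⟩ := mem_closure_iff_seq_limit.1
    (show (x : RepProd S) ∈ closure (StarAlgebra.adjoin ℂ (Set.range (prodGen (S := S))) :
      Set (RepProd S)) from x.2)
  choose y hy hyu using fun n => key (u n) (hu n)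
  refine mem_closure_iff_seq_limit.2 ⟨y, hy, tendsto_subtype_rng.2 ?_⟩
  simpa only [hyu] using hux

namespace IsKMSState

variable {S : Type*} [Monoid S] {N : Scale S} {φ ψ : CS S →L[ℂ] ℂ}

lemma mul_star_gen (hφ : IsKMSState (dyn N) 1 φ) (x : CS S) (t : S) :
    φ (x * star (CS.gen t)) = (N t : ℂ)⁻¹ * φ (star (CS.gen t) * x) := by
  have h1 : x * star (CS.gen t) = star (CS.gen t * star x) := by rw [star_mul, star_star]
  have h2 : star (CS.gen t) * x = star (star x * CS.gen t) := by rw [star_mul, star_star]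
  rw [h1, h2, hφ.1.map_star, hφ.1.map_star, hφ.gen_mul, star_mul', star_inv₀, Complex.star_def,
    Complex.conj_ofReal]

/-- Moving `v_s` around and moving `v_t^*` around both lead to `φ (v_t^* v_s)`, with factors `(N
s)⁻¹` and `(N t)⁻¹`. If these differ, the value is zero. -/
lemma monomial_eq_zero (hφ : IsKMSState (dyn N) 1 φ) {s t : S} (h : N s ≠ N t) :
    φ (CS.gen s * star (CS.gen t)) = 0 := by
  have h1 := hφ.gen_mul s (star (CS.gen t))
  have h2 := hφ.mul_star_gen (CS.gen s) t
  have hs : (N s : ℂ) ≠ 0 := Complex.ofReal_ne_zero.2 (N.pos s).ne'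
  have ht : (N t : ℂ) ≠ 0 := Complex.ofReal_ne_zero.2 (N.pos t).ne'
  have h3 : ((N s : ℂ) - N t) * φ (star (CS.gen t) * CS.gen s) = 0 := by
    rw [h1] at h2
    field_simp at h2
    linear_combination -h2
  have h4 : (N s : ℂ) - N t ≠ 0 := sub_ne_zero.2 fun e => h (Complex.ofReal_injective e)
  rw [h1, (mul_eq_zero.1 h3).resolve_left h4, mul_zero]

/-- KMS-states at inverse temperature `1` are determined by their values on `ker N`. -/
lemma eq_of_eq_ker (hS : IsRightLCM S) (hiso : N.OneIsolated) (hφ : IsKMSState (dyn N) 1 φ)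
    (hψ : IsKMSState (dyn N) 1 ψ)
    (hker : ∀ s ∈ N.ker, ∀ t ∈ N.ker,
      φ (CS.gen s * star (CS.gen t)) = ψ (CS.gen s * star (CS.gen t))) : φ = ψ := by
  have hv := CS.gen_isRep S
  have hmon : ∀ s t, φ (CS.gen s * star (CS.gen t)) = ψ (CS.gen s * star (CS.gen t)) := by
    intro s t
    by_cases hN : N s = N t
    · let f : S → S → ℝ := fun s t => ‖(φ - ψ) (CS.gen s * star (CS.gen t))‖
      have hf : f s t = 0 := by
        refine hiso.eq_zero_of_step (f := f) (C := ‖φ - ψ‖ * (1 * 1)) (fun s t => ?_)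
          (fun s hs t ht => ?_) (fun s t hst => ?_) hN
        · rw [abs_of_nonneg (norm_nonneg _)]
          refine ((φ - ψ).le_opNorm _).trans ?_
          gcongr
          refine (norm_mul_le _ _).trans ?_
          rw [norm_star]
          exact mul_le_mul (hv.norm_le s) (hv.norm_le t) (norm_nonneg _) zero_le_one
        · simp only [f]
          rw [sub_apply, hker s hs t ht, sub_self, norm_zero]
        · have h1 : f s t = (N s)⁻¹ * ‖(φ - ψ) (star (CS.gen t) * CS.gen s)‖ := by
            simp only [f]
            rw [sub_apply, sub_apply, hφ.gen_mul,
              hψ.gen_mul, ← mul_sub, norm_mul, norm_inv, Complex.norm_real, Real.norm_eq_abs,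
              abs_of_pos (N.pos s)]
          obtain he | hne := (rightIdeal s ∩ rightIdeal t).eq_empty_or_nonempty
          · refine ⟨1, 1, rfl, ?_⟩
            rw [h1, hv.star_mul_eq_zero he, map_zero, norm_zero, mul_zero, abs_zero]
            exact mul_nonneg (inv_nonneg.2 (N.pos s).le) (abs_nonneg _)
          · obtain ⟨p, q, e, hpq⟩ := hS.exists_lcm hne
            -- The order is reversed because `v_t^* v_s = v_q v_p^*`.
            refine ⟨q, p, ?_, ?_⟩
            · have := congrArg N.toHom e
              rw [N.map_mul, N.map_mul, ← hst] at this
              exact (mul_left_cancel₀ (N.pos s).ne' this).symm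
            · rw [h1, hv.star_mul_eq e hpq, abs_of_nonneg
                (mul_nonneg (inv_nonneg.2 (N.pos s).le) (norm_nonneg _)),
                abs_of_nonneg (norm_nonneg _)]
      exact sub_eq_zero.1 (norm_eq_zero.1 hf)
    · rw [hφ.monomial_eq_zero hN, hψ.monomial_eq_zero hN]
  refine DFunLike.coe_injective ((φ.continuous.ext_on (CS.dense_monomialSpan hS) ψ.continuous) ?_)
  intro x hx
  exact LinearMap.eqOn_span (f := φ.toLinearMap) (g := ψ.toLinearMap)
    (by rintro _ ⟨⟨s, t⟩, rfl⟩; exact hmon s t) hx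

end IsKMSState

end RightLCM

theorem mainTheorem10 {S : Type*} [Monoid S] [IsLeftCancelMul S] [Countable S]
    (hS : RightLCM.IsRightLCM S) (N : RightLCM.Scale S)
    (hex : (∃ μ : Measure (RightLCM.CharSpace S), IsProbabilityMeasure μ ∧
        ∀ s, μ (RightLCM.Z s) = ENNReal.ofReal (N s)⁻¹) ∨
      ∃ φ : RightLCM.CS S →L[ℂ] ℂ, RightLCM.IsKMSState (RightLCM.dyn N) 1 φ)
    (hiso : N.OneIsolated) :
    -- KMS_1-states are determined by their restriction to `C*(ker N)`
    (∃ ι : RightLCM.CS N.ker →⋆ₐ[ℂ] RightLCM.CS S,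
      (∀ t : N.ker, ι (RightLCM.CS.gen t) = RightLCM.CS.gen (t : S)) ∧
      ∀ φ ψ : RightLCM.CS S →L[ℂ] ℂ,
        RightLCM.IsKMSState (RightLCM.dyn N) 1 φ → RightLCM.IsKMSState (RightLCM.dyn N) 1 ψ →
        (∀ x, φ (ι x) = ψ (ι x)) → φ = ψ) ∧
    -- the numbers in the uniqueness criterion are well defined
    (∀ a b : S, (RightLCM.rightIdeal a ∩ RightLCM.rightIdeal b).Nonempty →
      (∃! x, RightLCM.QuotN.IsTrivNumber N a b x) ∧
      (∃! y, RightLCM.QuotN.IsFixNumber N a b y)) ∧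
    -- failure of the criterion shows up in `ker N`
    ((∃ a b : S, a ≠ b ∧ (RightLCM.rightIdeal a ∩ RightLCM.rightIdeal b).Nonempty ∧
        N a = N b ∧ RightLCM.QuotN.CriterionFails N a b) →
      ∃ a ∈ N.ker, ∃ b ∈ N.ker, a ≠ b ∧
        (RightLCM.rightIdeal a ∩ RightLCM.rightIdeal b).Nonempty ∧
        N a = N b ∧ RightLCM.QuotN.CriterionFails N a b) := by
  -- Only the existence of a model matters from here on, so the two alternative assumptions are
  -- merged.
  have hν : N.KerOre ∧ ∃ ν : Measure (Set (RightLCM.QuotN N)), RightLCM.QuotN.IsSpectral ν := by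
    obtain ⟨μ, _, hμ⟩ | ⟨φ, hφ⟩ := hex
    · have hW := RightLCM.isModel_charSpace hμ
      exact ⟨hW.kerOre hS, hW.exists_isSpectral hS⟩
    · obtain ⟨X, _, μ, W, hW⟩ := hφ.exists_isModel hS
      exact ⟨hW.kerOre hS, hW.exists_isSpectral hS⟩
  obtain ⟨h, ν, hν⟩ := hν
  obtain ⟨ι, hι⟩ := RightLCM.exists_hom_ker hS h
  refine ⟨⟨ι, hι, fun φ ψ hφ hψ hφψ => hφ.eq_of_eq_ker hS hiso hψ fun s hs t ht => ?_⟩,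
    fun a b hab => hν.existsUnique_numbers hS h hab, ?_⟩
  · have := hφψ (RightLCM.CS.gen ⟨s, hs⟩ * star (RightLCM.CS.gen ⟨t, ht⟩))
    rwa [map_mul, map_star, hι, hι] at this
  · rintro ⟨a, b, -, hab, hN, hfail⟩
    exact hν.exists_ker_criterionFails hS h hiso hab hN hfail
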